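/- **Setting.** Let $d\in\{2,3\}$ and let $\Omega\subset\mathbb R^d$ be covered by a finite conforming mesh $\mathcal E_h$ that consists either of simplices, or of convex quadrilaterals ($d=2$) / convex hexahedra with plane faces ($d=3$). Let $h_K=\operatorname{diam}K$ and $h_e=\operatorname{diam}e$ for elements $K$ and facets $e$. Let $X_h$ be the space of functions on $\Omega$ whose restriction to each element is a polynomial in $\mathbb P_1$ (simplices), respectively in $\mathbb Q_1$ in the Cartesian coordinates (quadrilaterals, hexahedra). Let $\Gamma_h$ be the set of interior facets; each $e\in\Gamma_h$, $e=\partial K_1\cap\partial K_2$, has a fixed unit normal $n_e$ pointing from $K_1$ to $K_2$, $[v]=v|_{K_1}-v|_{K_2}$, and for a positive coefficient $A$ with traces $A_1,A_2$ $$\{A\,G\cdot n_e\}=\tfrac{A_2}{A_1+A_2}A_1G_1\cdot n_e+\tfrac{A_1}{A_1+A_2}A_2G_2\cdot n_e,\qquad \mathcal H(A_1,A_2)=\tfrac{2A_1A_2}{A_1+A_2}.$$ Each boundary facet belongs either to $\Gamma_D$ or to $\Gamma_N$. Let $X_{h,\Gamma_D}=\{w\in X_h: w=0\text{ on }\Gamma_D\}$.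 **Data.** Let the porosity $\phi$ and the time step $\tau$ be positive constants, $\rho_a\in\mathbb R$, $g\in\mathbb R^d$, $\theta\in\{-1,0,1\}$. Let $\kappa$ be constant on each element, $\lambda_a(s_a,s_v)$ measurable and $p_{c,a}(s_a)$ differentiable, and put $(\partial p_{c,a})^+=-p_{c,a}'$. Assume $$0<\kappa_*\le\kappa\le\kappa^*,\qquad 0<\underline C_{\lambda_a}\le\lambda_a\le\overline C_{\lambda_a},\qquad 0<\underline C_{p_{c,a}}\le(\partial p_{c,a})^+\le\overline C_{p_{c,a}} .$$ Let the penalty parameters satisfy $0<\alpha_*\le\alpha_e\le\alpha^*$ for $e\in\Gamma_h$. Let $q_a^{n+1}\in L^\infty(\Omega)$, let $j^N$ be integrable on $\Gamma_N$, and let $s^{\mathrm{bdy}}$ be the trace on $\Gamma_D$ of a function in $X_h$. Let $S_a^n,S_v^n,P^{n+1}\in X_h$ be given, write $\lambda_a=\lambda_a(S_a^n,S_v^n)$ and $A=\kappa\,\lambda_a\,(\partial p_{c,a})^+(S_a^n)$, and let $u\in\mathbb{RT}_0$ be the Raviart--Thomas projection of $-\kappa\nabla P^{n+1}$, i.e.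 $$\int_e u\cdot n_e=-\int_e\{\kappa\nabla P^{n+1}\cdot n_e\}+\alpha_{p,e}h_e^{-1}\int_e\mathcal H\big((\kappa\lambda_t)|_{K_1},(\kappa\lambda_t)|_{K_2}\big)[P^{n+1}]\quad(e\in\Gamma_h),\qquad \int_e u\cdot n=-\int_e\kappa\nabla P^{n+1}\cdot n\quad(e\subset\partial\Omega),$$ where $\lambda_t=\lambda_\ell+\lambda_v+\lambda_a$ is the total mobility, evaluated at $(S_a^n,S_v^n)$, and the $\alpha_{p,e}$ are the penalty parameters of the pressure equation. Define $$\begin{aligned} b_a(v,w)=&\sum_K\int_K A\nabla v\cdot\nabla w-\sum_{e\in\Gamma_h}\int_e\{A\nabla v\cdot n_e\}[w]+\sum_{e\in\Gamma_h}\alpha_eh_e^{-1}\int_e\mathcal H(A_1,A_2)[v][w]+\theta\sum_{e\in\Gamma_h}\int_e\{A\nabla w\cdot n_e\}[v],\\ f_a(w)=&(q_a^{n+1},w)+\sum_K\int_K(\lambda_au+\kappa\rho_a\lambda_ag)\cdot\nabla w+\sum_{e\subset\Gamma_N}\int_ej^Nw-\sum_{e\in\Gamma_h}\int_e\lambda_a^{\uparrow}\,u\cdot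 n_e\,[w]-\sum_{e\in\Gamma_h}\int_e\{\rho_a\kappa\lambda_a\,g\cdot n_e\}[w], \end{aligned}$$ where $\lambda_a^\uparrow=\lambda_a|_{K_1}$ at the points of $e$ where the arithmetic mean of $(\lambda_au+\rho_a\kappa\lambda_ag)\cdot n_e$ over the two sides is $\ge0$, and $\lambda_a^\uparrow=\lambda_a|_{K_2}$ elsewhere. **Trace constant.** Let $C_{\mathrm{tr}}>0$ be such that $\|w\|_{L^2(e)}\le C_{\mathrm{tr}}h_K^{-1/2}\|w\|_{L^2(K)}$ for all $w\in X_h$, all elements $K$ and all facets $e$ of $K$; if $K$ is a hexahedron that is not an axis-parallel brick, let moreover $\|w\|_{L^2(\partial K)}\le C_{\mathrm{tr}}h_K^{-1/2}\|w\|_{L^2(K)}$. **Claim.** If $$\alpha_*>\tfrac14(1-\theta)^2\big(\overline C_{\lambda_a}\overline C_{p_{c,a}}\kappa^*\big)^3\big(\underline C_{\lambda_a}\underline C_{p_{c,a}}\kappa_*\big)^{-3}C_{\mathrm{tr}}^2,$$ then the discrete aqueous saturation problem has a unique solution: there is exactly one $S\in X_h$ with $S=s^{\mathrm{bdy}}$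 on $\Gamma_D$ and $$\tfrac1\tau(\phi S,w)+b_a(S,w)=\tfrac1\tau(\phi S_a^n,w)+f_a(w)\qquad\text{for all } w\in X_{h,\Gamma_D}.$$ -/

import Mathlib

open MeasureTheory
open scoped ContDiff

noncomputable section

namespace ThreePhaseDG

/-- The physical space `ℝ^d` with its Euclidean norm. -/
abbrev Space (d : ℕ) := EuclideanSpace ℝ (Fin d)

/-! ### Elements -/

/-- The two kinds of meshes: simplices, or quadrilaterals (`d = 2`) / hexahedra (`d = 3`). -/
inductive Shape where
  | simplex
  | cuboid

/-- Vertex labels: `0, …, d` for a simplex, the corners of the `d`-cube for a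
quadrilateral / hexahedron. -/
def Shape.Vertex : Shape → ℕ → Type
  | .simplex, d => Fin (d + 1)
  | .cuboid, d => Fin d → Bool

/-- Facet labels (edges for `d = 2`, faces for `d = 3`): the opposite vertex for a simplex, a pair
(direction, side) for a quadrilateral / hexahedron. -/
def Shape.Facet : Shape → ℕ → Type
  | .simplex, d => Fin (d + 1)
  | .cuboid, d => Fin d × Bool

/-- The vertex `i` lies on the facet `j`. -/
def Shape.Incident : (s : Shape) → (d : ℕ) → s.Vertex d → s.Facet d → Prop
  | .simplex, d => fun (i j : Fin (d + 1)) => i ≠ j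
  | .cuboid, d => fun (i : Fin d → Bool) (j : Fin d × Bool) => i j.1 = j.2

instance Shape.instFintypeFacet : (s : Shape) → (d : ℕ) → Fintype (s.Facet d)
  | .simplex, d => inferInstanceAs (Fintype (Fin (d + 1)))
  | .cuboid, d => inferInstanceAs (Fintype (Fin d × Bool))

/-- A nondegenerate convex element with planar facets. The element is the convex hull of its
vertices; each facet lies in a supporting hyperplane, with outward unit normal `normal j`, that
contains no other vertex. For `simplex` this says exactly that the vertices are affinely
independent; for `cuboid` it gives the strictly convex quadrilaterals and the convex hexahedra
with plane quadrilateral faces. The fields `normal` and `offset` are determined by `vertex`. -/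
structure Cell (s : Shape) (d : ℕ) where
  vertex : s.Vertex d → Space d
  normal : s.Facet d → Space d
  offset : s.Facet d → ℝ
  norm_normal : ∀ j, ‖normal j‖ = 1
  on_facet : ∀ i j, s.Incident d i j → inner ℝ (normal j) (vertex i) = offset j
  off_facet : ∀ i j, ¬ s.Incident d i j → inner ℝ (normal j) (vertex i) < offset j

namespace Cell

variable {s : Shape} {d : ℕ}

/-- The element `K` as a closed set. -/
def carrier (K : Cell s d) : Set (Space d) := convexHull ℝ (Set.range K.vertex)

/-- The closed facet with label `j`. -/
def facet (K : Cell s d) (j : s.Facet d) : Set (Space d) :=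
  convexHull ℝ (K.vertex '' {i | s.Incident d i j})

/-- The face of `K` in which the facets with labels in `S` meet (possibly empty). -/
def face (K : Cell s d) (S : Set (s.Facet d)) : Set (Space d) :=
  convexHull ℝ (K.vertex '' {i | ∀ j ∈ S, s.Incident d i j})

/-- All facets are perpendicular to coordinate axes: for `cuboid`, `K` is an axis-parallel
rectangle or brick. -/
def IsAxisParallel (K : Cell s d) : Prop :=
  ∀ j, ∃ i : Fin d, K.normal j = EuclideanSpace.single i 1 ∨
    K.normal j = -EuclideanSpace.single i 1

/-- `K` is a hexahedron that is not an axis-parallel brick. -/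
def IsGeneralHexahedron (K : Cell s d) : Prop :=
  s = .cuboid ∧ d = 3 ∧ ¬ K.IsAxisParallel

end Cell

/-! ### Meshes -/

/-- A conforming mesh: two distinct elements meet in a common proper face of both (possibly empty),
and no facet belongs to three elements. -/
structure Mesh (s : Shape) (d : ℕ) where
  numCells : ℕ
  numCells_pos : 0 < numCells
  cell : Fin numCells → Cell s d
  conforming : ∀ K L, K ≠ L → ∃ S T : Set (s.Facet d), S.Nonempty ∧ T.Nonempty ∧
    (cell K).carrier ∩ (cell L).carrier = (cell K).face S ∧
    (cell K).carrier ∩ (cell L).carrier = (cell L).face T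
  facet_shared : ∀ K L M j k l, K ≠ L → K ≠ M →
    (cell K).facet j = (cell L).facet k → (cell K).facet j = (cell M).facet l → L = M

namespace Mesh

variable {s : Shape} {d : ℕ} (M : Mesh s d)

/-- The open domain `Ω` covered by the mesh. -/
def domain : Set (Space d) := interior (⋃ K, (M.cell K).carrier)

/-- The diameter `h_K` of an element. -/
def hCell (K : Fin M.numCells) : ℝ := Metric.diam (M.cell K).carrier

/-- The diameter `h_e` of a facet. -/
def hFacet (K : Fin M.numCells) (j : s.Facet d) : ℝ := Metric.diam ((M.cell K).facet j)

/-- Lebesgue measure on an element. -/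
def cellMeasure (K : Fin M.numCells) : Measure (Space d) := volume.restrict (M.cell K).carrier

/-- The `(d-1)`-dimensional surface measure on a facet. -/
def facetMeasure (K : Fin M.numCells) (j : s.Facet d) : Measure (Space d) :=
  (μHE[d - 1] : Measure (Space d)).restrict ((M.cell K).facet j)

/-- An interior facet `e`, together with a choice of which of its two elements is
`K₁ = left` and which is `K₂ = right`. -/
structure InteriorFacet where
  left : Fin M.numCells
  right : Fin M.numCells
  leftLabel : s.Facet d
  rightLabel : s.Facet d
  ne : left ≠ right
  same : (M.cell left).facet leftLabel = (M.cell right).facet rightLabel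

namespace InteriorFacet

variable {M}

/-- The same facet with the roles of the two elements exchanged. -/
def swap (e : M.InteriorFacet) : M.InteriorFacet :=
  ⟨e.right, e.left, e.rightLabel, e.leftLabel, e.ne.symm, e.same.symm⟩

/-- The unit normal `n_e`, pointing from `K₁` into `K₂`. -/
def normal (e : M.InteriorFacet) : Space d := (M.cell e.left).normal e.leftLabel

/-- The size `h_e`. -/
def size (e : M.InteriorFacet) : ℝ := M.hFacet e.left e.leftLabel

/-- Surface measure on `e`. -/
def measure (e : M.InteriorFacet) : Measure (Space d) := M.facetMeasure e.left e.leftLabel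

end InteriorFacet

/-- The set `Γ_h` of interior facets, each taken once, i.e. with one fixed orientation. -/
structure Skeleton where
  facets : Finset M.InteriorFacet
  once : ∀ e : M.InteriorFacet, Xor (e ∈ facets) (e.swap ∈ facets)

/-- The facets that belong to one element only: they make up `∂Ω`. -/
def BoundaryFacet : Type :=
  {f : Fin M.numCells × s.Facet d //
    ∀ L k, L ≠ f.1 → (M.cell L).facet k ≠ (M.cell f.1).facet f.2}

instance : Fintype M.BoundaryFacet := by
  classical
  unfold BoundaryFacet
  infer_instance

end Mesh

/-! ### Polynomial spaces -/

/-- `P_{k_1,…,k_d}`: polynomials of degree at most `k_i` in the Cartesian coordinate `x_i`. -/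
def boxPoly {d : ℕ} (k : Fin d → ℕ) : Submodule ℝ (Space d → ℝ) :=
  Submodule.span ℝ {f | ∃ m : Fin d → ℕ, (∀ i, m i ≤ k i) ∧ f = fun x => ∏ i, x i ^ m i}

/-- The local space: `P_1` on simplices, `Q_1` on quadrilaterals and hexahedra. -/
def localSpace : (s : Shape) → (d : ℕ) → Submodule ℝ (Space d → ℝ)
  | .simplex, _ =>
    Submodule.span ℝ {f | ∃ m : Fin _ → ℕ, (∑ i, m i ≤ 1) ∧ f = fun x => ∏ i, x i ^ m i}
  | .cuboid, _ => boxPoly (fun _ => 1)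

/-- Membership in the local Raviart--Thomas space `RT_0(K)`. -/
def IsLocalRT : (s : Shape) → {d : ℕ} → (Space d → Space d) → Prop
  | .simplex, d, u => ∃ (a : Space d) (b : ℝ), u = fun x => a + b • x
  | .cuboid, _, u => ∀ i, (fun x => u x i) ∈ boxPoly (Pi.single i 1)

namespace Mesh

variable {s : Shape} {d : ℕ} (M : Mesh s d)

/-- Element-wise defined functions on the mesh: `v K` stands for `v|_K`. -/
abbrev Broken (F : Type) := Fin M.numCells → Space d → F

/-- The discontinuous space `X_h`: one polynomial of the local space on each element. (As elements
have non-empty interior, such families correspond one-to-one to the functions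
`v ∈ L²(Ω)` with `v|_K` in the local space.) -/
def dgSpace : Submodule ℝ (M.Broken ℝ) := Submodule.pi Set.univ (fun _ => localSpace s d)

/-- The `L²(Ω)` inner product. -/
def l2Inner (v w : M.Broken ℝ) : ℝ := ∑ K, ∫ x, v K x * w K x ∂M.cellMeasure K

/-- `C > 0` is a constant of the trace inequality
`‖w‖_{L²(e)} ≤ C h_K^{-1/2} ‖w‖_{L²(K)}` for all `w ∈ X_h`, all elements `K` and all facets
`e` of `K`. On hexahedra that are not bricks the whole boundary `∂K` takes the place of `e`. -/
def IsTraceConstant (C : ℝ) : Prop :=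
  0 < C ∧ ∀ w ∈ M.dgSpace, ∀ K,
    (∀ j, √(∫ x, w K x ^ 2 ∂M.facetMeasure K j) ≤
      C * M.hCell K ^ (-(1 / 2) : ℝ) * √(∫ x, w K x ^ 2 ∂M.cellMeasure K)) ∧
    ((M.cell K).IsGeneralHexahedron →
      √(∑ j, ∫ x, w K x ^ 2 ∂M.facetMeasure K j) ≤
        C * M.hCell K ^ (-(1 / 2) : ℝ) * √(∫ x, w K x ^ 2 ∂M.cellMeasure K))

variable {M}

/-- The jump `[v] = v|_{K₁} - v|_{K₂}` across an interior facet. -/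
def jump (v : M.Broken ℝ) (e : M.InteriorFacet) (x : Space d) : ℝ := v e.left x - v e.right x

/-- The weighted average `{A G · n_e} = ω₁ A₁ G₁ · n_e + ω₂ A₂ G₂ · n_e` with
`ω₁ = A₂ / (A₁ + A₂)` and `ω₂ = A₁ / (A₁ + A₂)`. -/
def weightedAvg (A : M.Broken ℝ) (G : M.Broken (Space d)) (e : M.InteriorFacet) (x : Space d) : ℝ :=
  A e.right x / (A e.left x + A e.right x) * (A e.left x * inner ℝ (G e.left x) e.normal) +
  A e.left x / (A e.left x + A e.right x) * (A e.right x * inner ℝ (G e.right x) e.normal)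

/-- The harmonic average of the two traces of `A` on an interior facet. -/
def harmonicAvg (A : M.Broken ℝ) (e : M.InteriorFacet) (x : Space d) : ℝ :=
  2 * A e.left x * A e.right x / (A e.left x + A e.right x)

/-- The broken gradient `∇_h v`. -/
def brokenGrad (v : M.Broken ℝ) : M.Broken (Space d) := fun K x => gradient (v K) x

/-- The broken vector field `u` is in `H(div, Ω)`: it has a weak divergence in `L²(Ω)`. -/
def HasL2Div (u : M.Broken (Space d)) : Prop :=
  ∃ g : Space d → ℝ, MemLp g 2 (volume.restrict M.domain) ∧
    ∀ ψ : Space d → ℝ, ContDiff ℝ ∞ ψ → HasCompactSupport ψ → tsupport ψ ⊆ M.domain →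
      ∑ K, ∫ x, inner ℝ (u K x) (gradient ψ x) ∂M.cellMeasure K = -∫ x in M.domain, g x * ψ x

end Mesh

/-! ### The aqueous saturation problem -/

/-- The data of the three-phase flow problem and of the scheme (no property is required here).
Mobilities are functions `λ(s_a, s_v)`. -/
structure FlowData {s : Shape} {d : ℕ} (M : Mesh s d) where
  /-- the oriented interior facets `Γ_h` -/
  skeleton : M.Skeleton
  /-- the boundary facets that make up the Dirichlet part `Γ_D^{s_a}`; the others make up
  `Γ_N^{s_a}` -/
  dirichlet : Set M.BoundaryFacet
  /-- liquid mobility -/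
  lamL : ℝ → ℝ → ℝ
  /-- vapor mobility -/
  lamV : ℝ → ℝ → ℝ
  /-- aqueous mobility -/
  lamA : ℝ → ℝ → ℝ
  /-- capillary pressure `p_{c,a}(s_a)` -/
  pca : ℝ → ℝ
  /-- permeability, constant on each element -/
  kappa : Fin M.numCells → ℝ
  /-- porosity -/
  phi : ℝ
  /-- aqueous density -/
  rhoA : ℝ
  /-- gravity -/
  grav : Space d
  /-- source term `q_a(t, x)` -/
  qA : ℝ → Space d → ℝ
  /-- Neumann datum `j_{s_a}^N` -/
  jN : Space d → ℝ
  /-- Dirichlet datum `s_a^bdy` -/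
  sBdy : Space d → ℝ
  /-- time step -/
  tau : ℝ
  /-- `-1` (symmetric), `0` (incomplete) or `1` (nonsymmetric) -/
  theta : ℝ
  /-- penalty parameters `α_{s_a,e}` -/
  alphaA : M.InteriorFacet → ℝ
  /-- penalty parameters `α_{p_ℓ,e}` -/
  alphaP : M.InteriorFacet → ℝ

namespace FlowData

open Mesh

variable {s : Shape} {d : ℕ} {M : Mesh s d} (D : FlowData M)

/-- `λ_a^n = λ_a(S_a^n, S_v^n)`. -/
def mobA (Sa Sv : M.Broken ℝ) : M.Broken ℝ := fun K x => D.lamA (Sa K x) (Sv K x)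

/-- `κ λ_t^n` with `λ_t = λ_ℓ + λ_v + λ_a`. -/
def coeffP (Sa Sv : M.Broken ℝ) : M.Broken ℝ := fun K x =>
  D.kappa K * (D.lamL (Sa K x) (Sv K x) + D.lamV (Sa K x) (Sv K x) + D.lamA (Sa K x) (Sv K x))

/-- `κ λ_a^n (∂p_{c,a})^{+,n}` with `(∂p_{c,a})^+ = -∂p_{c,a}`. -/
def coeffA (Sa Sv : M.Broken ℝ) : M.Broken ℝ := fun K x =>
  D.kappa K * D.mobA Sa Sv K x * (-deriv D.pca (Sa K x))

/-- `ρ_a κ λ_a^n`. -/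
def coeffG (Sa Sv : M.Broken ℝ) : M.Broken ℝ := fun K x =>
  D.rhoA * D.kappa K * D.mobA Sa Sv K x

/-- `u` is the projection `Π_RT(-κ ∇P)` of the discrete Darcy velocity, `P = P_h^{n+1}`, onto the
Raviart--Thomas space `RT_0`; the penalty coefficient is evaluated at `S_a^n`, `S_v^n`. -/
def IsRTProjection (Sa Sv P : M.Broken ℝ) (u : M.Broken (Space d)) : Prop :=
  (∀ K, IsLocalRT s (u K)) ∧ HasL2Div u ∧
  (∀ e ∈ D.skeleton.facets, ∀ q : ℝ,
    ∫ x, inner ℝ (u e.left x) e.normal * q ∂e.measure =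
      -(∫ x, weightedAvg (fun K _ => D.kappa K) (brokenGrad P) e x * q ∂e.measure) +
      D.alphaP e * e.size⁻¹ *
        ∫ x, harmonicAvg (D.coeffP Sa Sv) e x * jump P e x * q ∂e.measure) ∧
  (∀ f : M.BoundaryFacet, ∀ q : ℝ,
    ∫ x, inner ℝ (u f.1.1 x) ((M.cell f.1.1).normal f.1.2) * q ∂M.facetMeasure f.1.1 f.1.2 =
      -∫ x, D.kappa f.1.1 * inner ℝ (brokenGrad P f.1.1 x) ((M.cell f.1.1).normal f.1.2) * q
        ∂M.facetMeasure f.1.1 f.1.2)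

/-- The bilinear form `b_a^n(v, w)`. -/
def bA (Sa Sv v w : M.Broken ℝ) : ℝ :=
  (∑ K, ∫ x, D.coeffA Sa Sv K x * inner ℝ (brokenGrad v K x) (brokenGrad w K x) ∂M.cellMeasure K)
  - (∑ e ∈ D.skeleton.facets,
      ∫ x, weightedAvg (D.coeffA Sa Sv) (brokenGrad v) e x * jump w e x ∂e.measure)
  + (∑ e ∈ D.skeleton.facets, D.alphaA e * e.size⁻¹ *
      ∫ x, harmonicAvg (D.coeffA Sa Sv) e x * jump v e x * jump w e x ∂e.measure)
  + D.theta * (∑ e ∈ D.skeleton.facets,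
      ∫ x, weightedAvg (D.coeffA Sa Sv) (brokenGrad w) e x * jump v e x ∂e.measure)

open Classical in
/-- The upwind value of `λ_a^n` on an interior facet: the value from `K₁` if
`{λ_a^n u + ρ_a κ λ_a^n g}_{1/2} · n_e ≥ 0`, the value from `K₂` otherwise. -/
def upwind (Sa Sv : M.Broken ℝ) (u : M.Broken (Space d)) (e : M.InteriorFacet) (x : Space d) : ℝ :=
  if 0 ≤ inner ℝ
      ((1 / 2 : ℝ) • ((D.mobA Sa Sv e.left x • u e.left x + D.coeffG Sa Sv e.left x • D.grav) +
        (D.mobA Sa Sv e.right x • u e.right x + D.coeffG Sa Sv e.right x • D.grav))) e.normal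
  then D.mobA Sa Sv e.left x else D.mobA Sa Sv e.right x

open Classical in
/-- The linear form `f_a^n(w)`, for the time step from `t_n` to `t_{n+1} = (n + 1) τ`. -/
def fA (n : ℕ) (Sa Sv : M.Broken ℝ) (u : M.Broken (Space d)) (w : M.Broken ℝ) : ℝ :=
  M.l2Inner (fun _ => D.qA ((n + 1) * D.tau)) w
  + (∑ K, ∫ x, inner ℝ (D.mobA Sa Sv K x • u K x
      + (D.kappa K * D.rhoA * D.mobA Sa Sv K x) • D.grav) (brokenGrad w K x) ∂M.cellMeasure K)
  + (∑ f : M.BoundaryFacet with f ∉ D.dirichlet,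
      ∫ x, D.jN x * w f.1.1 x ∂M.facetMeasure f.1.1 f.1.2)
  - (∑ e ∈ D.skeleton.facets,
      ∫ x, D.upwind Sa Sv u e x * inner ℝ (u e.left x) e.normal * jump w e x ∂e.measure)
  - (∑ e ∈ D.skeleton.facets,
      ∫ x, weightedAvg (D.coeffG Sa Sv) (fun _ _ => D.grav) e x * jump w e x ∂e.measure)

/-- `v = s` on `Γ_D^{s_a}` (in the sense of traces). -/
def EqOnDirichlet (v : M.Broken ℝ) (g : Space d → ℝ) : Prop :=
  ∀ f ∈ D.dirichlet, ∀ᵐ x ∂M.facetMeasure f.1.1 f.1.2, v f.1.1 x = g x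

/-- `S = S_{a_h}^{n+1}` solves the discrete aqueous saturation problem, given the saturations
`Sa = S_{a_h}^n`, `Sv = S_{v_h}^n` and the projected velocity `u = u_h^{n+1}`. -/
def IsAqueousSolution (n : ℕ) (Sa Sv : M.Broken ℝ) (u : M.Broken (Space d)) (S : M.Broken ℝ) :
    Prop :=
  S ∈ M.dgSpace ∧ D.EqOnDirichlet S D.sBdy ∧
  ∀ w ∈ M.dgSpace, D.EqOnDirichlet w 0 →
    1 / D.tau * M.l2Inner (D.phi • S) w + D.bA Sa Sv S w =
      1 / D.tau * M.l2Inner (D.phi • Sa) w + D.fA n Sa Sv u w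

end FlowData

end ThreePhaseDG

end

/-!
The problem is linear and finite-dimensional: with a discrete lift `g` of the Dirichlet datum, the
unknown `S - g` ranges over the test space. So it suffices that the form
`B(v, w) = (φ v, w) / τ + b_a(v, w)` is definite on the test space (`existsUnique_of_definite`), and
since `(φ z, z)` vanishes only for `z = 0`, everything comes down to `b_a(z, z) ≥ 0`
(`FlowData.bA_self_nonneg`).

The consistency terms of `b_a(z, z)` combine to `-(1 - θ) ∫ {A ∇z · n} [z]`. Young's inequality
absorbs `[z]` in the penalty term and leaves `h_e (|∇z₁ · n|² + |∇z₂ · n|²)` on each interior facet.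
A pair of an element and one of its facets occurs in the skeleton at most once
(`Mesh.Skeleton.sum_sides_le`), so that the remaining task is an estimate on a single element `K`:
`∑_e h_e ∫_e (∇z · n_e)² ≤ 2 C² ∫_K |∇z|²` (`Mesh.IsTraceConstant.sum_normal_le`). The factor `2` is
just what the penalty condition allows, whereas the number of facets, which a direct use of the
trace inequality gives, would be too much. It is obtained as follows.

* In the plane, `∑_e h_e (n_e · G)² ≤ 2 h_K |G|²` for every vector `G`
  (`Cell.sum_diam_mul_sq_inner_normal_le`), since the boundary of a convex polygon covers its
  projection to a line twice. The trace inequality is applied to `∇z · n_e` with `n_e` constant,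
  which is again in the local space.
* For a brick the same holds because each coordinate axis carries at most two facet normals.
* For a tetrahedron `∇z` is constant, and the trace inequality is applied to `1 - 2 λ_j`, which is
  `1` on the face `j` and has mean square at most `1 / 2` on `K`
  (`Cell.integral_sq_one_sub_two_baryCoord_le`); so each of the four faces
  contributes at most `1 / 2`.
* For any other hexahedron the trace inequality holds on the whole boundary.
-/

noncomputable section

namespace ThreePhaseDG

/-! ### Geometry of a cell -/

instance Shape.instFiniteVertex : (s : Shape) → (d : ℕ) → Finite (s.Vertex d)
  | .simplex, d => inferInstanceAs (Finite (Fin (d + 1)))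
  | .cuboid, d => inferInstanceAs (Finite (Fin d → Bool))

lemma Shape.nonempty_facet (s : Shape) {d : ℕ} (hd : 0 < d) : Nonempty (s.Facet d) := by
  cases s with
  | simplex => exact ⟨(0 : Fin (d + 1))⟩
  | cuboid => exact ⟨((⟨0, hd⟩ : Fin d), true)⟩

/-- Every facet label `j` has a *corner*: a vertex `v₀` with `d` neighbours `x i` and `d` facets
`F k ∋ v₀`, one of them `j`, such that `x i` fails to lie on `F k` exactly for `i = k`. -/
lemma Shape.exists_corner (s : Shape) {d : ℕ} (hd : 0 < d) (j : s.Facet d) :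
    ∃ (v₀ : s.Vertex d) (x : Fin d → s.Vertex d) (F : Fin d → s.Facet d) (k₀ : Fin d),
      F k₀ = j ∧ (∀ k, s.Incident d v₀ (F k)) ∧ ∀ i k, s.Incident d (x i) (F k) ↔ i ≠ k := by
  cases s with
  | simplex =>
    change Fin (d + 1) at j
    have : Nontrivial (Fin (d + 1)) := Fin.nontrivial_iff_two_le.2 (by omega)
    obtain ⟨v, hv⟩ := exists_ne j
    obtain ⟨k₀, hk₀⟩ := Fin.exists_succAbove_eq hv.symm
    exact ⟨v, v.succAbove, v.succAbove, k₀, hk₀, fun k => (Fin.succAbove_ne v k).symm,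
      fun i k => Fin.succAbove_right_injective.ne_iff (x := i) (y := k)⟩
  | cuboid =>
    obtain ⟨i₀, b⟩ : Fin d × Bool := j
    refine ⟨fun _ => b, fun i => Function.update (fun _ => b) i (!b), fun k => (k, b), i₀, rfl,
      fun k => rfl, fun i k => ?_⟩
    change Function.update (fun _ => b) i (!b) k = b ↔ i ≠ k
    by_cases h : i = k
    · subst h; simp
    · simp [Function.update_of_ne (Ne.symm h), h]

lemma Shape.exists_incident_not_incident (s : Shape) {d : ℕ} {j k : s.Facet d} (h : j ≠ k) :
    ∃ i, s.Incident d i j ∧ ¬ s.Incident d i k := by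
  cases s with
  | simplex => exact ⟨k, Ne.symm h, fun h' => h' rfl⟩
  | cuboid =>
    obtain ⟨a, b⟩ : Fin d × Bool := j
    obtain ⟨a', b'⟩ : Fin d × Bool := k
    change ∃ i : Fin d → Bool, i a = b ∧ ¬ i a' = b'
    by_cases ha : a = a'
    · subst ha
      exact ⟨fun _ => b, rfl, fun hb => h (by subst hb; rfl)⟩
    · exact ⟨Function.update (fun _ => b) a' (!b'), by simp [Function.update_of_ne ha], by simp⟩

namespace Cell

variable {s : Shape} {d : ℕ} (K : Cell s d)

lemma isCompact_carrier : IsCompact K.carrier :=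
  (Set.finite_range K.vertex).isCompact_convexHull ℝ

lemma isCompact_facet (j : s.Facet d) : IsCompact (K.facet j) :=
  (Set.Finite.image _ (Set.toFinite _)).isCompact_convexHull ℝ

lemma facet_subset_carrier (j : s.Facet d) : K.facet j ⊆ K.carrier :=
  convexHull_mono (Set.image_subset_range _ _)

lemma vertex_mem_facet {i : s.Vertex d} {j : s.Facet d} (h : s.Incident d i j) :
    K.vertex i ∈ K.facet j :=
  subset_convexHull ℝ _ (Set.mem_image_of_mem _ h)

lemma inner_normal_of_mem_facet {j : s.Facet d} {x : Space d} (hx : x ∈ K.facet j) :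
    inner ℝ (K.normal j) x = K.offset j := by
  have hconv : Convex ℝ {x : Space d | inner ℝ (K.normal j) x = K.offset j} :=
    convex_hyperplane (innerSL ℝ (K.normal j)).toLinearMap.isLinear _
  refine convexHull_min ?_ hconv hx
  rintro _ ⟨i, hi, rfl⟩
  exact K.on_facet i j hi

/-- At a corner, the edges are a basis that is dual, up to negative factors, to the normals of the
facets that meet there. -/
lemma linearIndependent_corner {v₀ : s.Vertex d} {x : Fin d → s.Vertex d} {F : Fin d → s.Facet d}
    (h₀ : ∀ k, s.Incident d v₀ (F k)) (hx : ∀ i k, s.Incident d (x i) (F k) ↔ i ≠ k) :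
    LinearIndependent ℝ (fun i => K.vertex (x i) - K.vertex v₀) := by
  rw [Fintype.linearIndependent_iff]
  intro g hg k
  have h := congrArg (fun y => inner ℝ (K.normal (F k)) y) hg
  simp only [inner_sum, inner_smul_right, inner_sub_right, inner_zero_right,
    K.on_facet _ _ (h₀ k)] at h
  rw [Finset.sum_eq_single k] at h
  · have hlt := K.off_facet (x k) (F k) (by simp [hx])
    rcases mul_eq_zero.1 h with h | h
    · exact h
    · linarith
  · intro i _ hik
    rw [K.on_facet _ _ ((hx i k).2 hik)]; ring
  · simp

lemma span_corner {v₀ : s.Vertex d} {x : Fin d → s.Vertex d} {F : Fin d → s.Facet d}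
    (h₀ : ∀ k, s.Incident d v₀ (F k)) (hx : ∀ i k, s.Incident d (x i) (F k) ↔ i ≠ k) :
    Submodule.span ℝ (Set.range fun i => K.vertex (x i) - K.vertex v₀) = ⊤ :=
  (K.linearIndependent_corner h₀ hx).span_eq_top_of_card_eq_finrank' (by simp)

/-- The unit normal of a facet is determined by the facet up to its sign. -/
lemma eq_or_eq_neg_normal (hd : 0 < d) (j : s.Facet d) {m : Space d} (hm : ‖m‖ = 1) {c : ℝ}
    (h : ∀ x ∈ K.facet j, inner ℝ m x = c) : m = K.normal j ∨ m = -K.normal j := by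
  obtain ⟨v₀, x, F, k₀, rfl, h₀, hx⟩ := s.exists_corner hd j
  set n := K.normal (F k₀)
  have hlt : inner ℝ n (K.vertex (x k₀) - K.vertex v₀) < 0 := by
    rw [inner_sub_right, K.on_facet _ _ (h₀ k₀)]
    linarith [K.off_facet (x k₀) (F k₀) (by simp [hx])]
  set t := inner ℝ m (K.vertex (x k₀) - K.vertex v₀) / inner ℝ n (K.vertex (x k₀) - K.vertex v₀)
    with ht
  have hmt : m = t • n := by
    rw [← sub_eq_zero]
    have hspan : m - t • n ∈ (Submodule.span ℝ
        (Set.range fun i => K.vertex (x i) - K.vertex v₀))ᗮ := by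
      rw [Submodule.mem_orthogonal']
      intro y hy
      induction hy using Submodule.span_induction with
      | zero => simp
      | add a b _ _ ha hb => rw [inner_add_right, ha, hb, add_zero]
      | smul r a _ ha => rw [inner_smul_right, ha, mul_zero]
      | mem y hy =>
        obtain ⟨i, rfl⟩ := hy
        by_cases hi : i = k₀
        · subst hi
          simp only
          rw [inner_sub_left, inner_smul_left, ht]
          simp only [conj_trivial]
          field_simp [hlt.ne]
          ring
        · simp only [inner_sub_left, inner_smul_left, inner_sub_right]
          rw [h _ (K.vertex_mem_facet (h₀ k₀)), h _ (K.vertex_mem_facet ((hx i k₀).2 hi)),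
            K.on_facet _ _ (h₀ k₀), K.on_facet _ _ ((hx i k₀).2 hi)]
          ring
    rwa [K.span_corner h₀ hx, Submodule.top_orthogonal_eq_bot, Submodule.mem_bot] at hspan
  have habs : |t| = 1 := by
    have := hm
    rw [hmt, norm_smul, K.norm_normal, mul_one, Real.norm_eq_abs] at this
    exact this
  rcases eq_or_eq_neg_of_abs_eq habs with h1 | h1
  · left; rw [hmt, h1, one_smul]
  · right; rw [hmt, h1, neg_smul, one_smul]

lemma facet_injective : Function.Injective K.facet := by
  intro j k h
  by_contra hjk
  obtain ⟨i, hij, hik⟩ := s.exists_incident_not_incident hjk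
  have := K.inner_normal_of_mem_facet (h ▸ K.vertex_mem_facet hij)
  exact (K.off_facet i k hik).ne this

lemma normal_injective : Function.Injective K.normal := by
  intro j k h
  by_contra hjk
  obtain ⟨p, hpj, hpk⟩ := s.exists_incident_not_incident hjk
  obtain ⟨q, hqk, hqj⟩ := s.exists_incident_not_incident (Ne.symm hjk)
  have h1 := K.on_facet p j hpj
  have h2 := K.off_facet p k hpk
  have h3 := K.on_facet q k hqk
  have h4 := K.off_facet q j hqj
  rw [h] at h1 h4
  linarith

lemma interior_carrier_nonempty (hd : 0 < d) : (interior K.carrier).Nonempty := by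
  obtain ⟨j⟩ := s.nonempty_facet hd
  obtain ⟨v₀, x, F, k₀, -, h₀, hx⟩ := s.exists_corner hd j
  rw [carrier, interior_convexHull_nonempty_iff_affineSpan_eq_top, ← top_le_iff]
  rw [AffineSubspace.affineSpan_eq_top_iff_vectorSpan_eq_top_of_nonempty ℝ (Space d) (Space d)
    ⟨_, Set.mem_range_self v₀⟩ |>.2]
  rw [← top_le_iff, ← K.span_corner h₀ hx, Submodule.span_le]
  rintro _ ⟨i, rfl⟩
  exact vsub_mem_vectorSpan ℝ (Set.mem_range_self _) (Set.mem_range_self _)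

lemma diam_facet_pos (hd : 2 ≤ d) (j : s.Facet d) : 0 < Metric.diam (K.facet j) := by
  obtain ⟨v₀, x, F, k₀, rfl, h₀, hx⟩ := s.exists_corner (by omega : 0 < d) j
  have : Nontrivial (Fin d) := Fin.nontrivial_iff_two_le.2 hd
  obtain ⟨i, hi⟩ := exists_ne k₀
  have hne : K.vertex (x i) - K.vertex v₀ ≠ 0 := (K.linearIndependent_corner h₀ hx).ne_zero i
  refine lt_of_lt_of_le (dist_pos.2 (sub_ne_zero.1 hne))
    (Metric.dist_le_diam_of_mem (K.isCompact_facet _).isBounded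
      (K.vertex_mem_facet ((hx i k₀).2 hi)) (K.vertex_mem_facet (h₀ k₀)))

lemma diam_facet_le (j : s.Facet d) : Metric.diam (K.facet j) ≤ Metric.diam K.carrier :=
  Metric.diam_mono (K.facet_subset_carrier j) K.isCompact_carrier.isBounded

lemma diam_carrier_pos (hd : 2 ≤ d) : 0 < Metric.diam K.carrier := by
  obtain ⟨j⟩ := s.nonempty_facet (by omega : 0 < d)
  exact (K.diam_facet_pos hd j).trans_le (K.diam_facet_le _)

lemma measure_facet_lt_top (hd : 0 < d) (j : s.Facet d) :
    (μHE[d - 1] : Measure (Space d)) (K.facet j) < ⊤ := by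
  obtain ⟨v₀, x, F, k₀, rfl, h₀, hx⟩ := s.exists_corner hd j
  set n := K.normal (F k₀)
  have hn : n ≠ 0 := by
    intro h; have := K.norm_normal (F k₀); rw [show K.normal (F k₀) = 0 from h] at this; simp at this
  let f : (ℝ ∙ n)ᗮ → Space d := fun y => (y : Space d) + K.vertex v₀
  have hf : Isometry f := (isometry_add_right (K.vertex v₀)).comp isometry_subtype_coe
  have hrank : Module.finrank ℝ (ℝ ∙ n)ᗮ = d - 1 := by
    have := Submodule.finrank_add_finrank_orthogonal (K := ℝ ∙ n)
    rw [finrank_span_singleton hn] at this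
    simp at this
    omega
  have himg : K.facet (F k₀) = f '' (f ⁻¹' K.facet (F k₀)) := by
    refine (Set.image_preimage_eq_iff.2 ?_).symm
    intro y hy
    refine ⟨⟨y - K.vertex v₀, ?_⟩, by simp [f]⟩
    rw [Submodule.mem_orthogonal_singleton_iff_inner_right, inner_sub_right,
      K.inner_normal_of_mem_facet hy, K.on_facet _ _ (h₀ k₀), sub_self]
  have hcomp : IsCompact (f ⁻¹' K.facet (F k₀)) :=
    hf.isClosedEmbedding.isCompact_preimage (K.isCompact_facet _)
  rw [himg, hf.euclideanHausdorffMeasure_image, ← hrank,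
    InnerProductSpace.euclideanHausdorffMeasure_eq_volume]
  exact hcomp.measure_lt_top

end Cell

/-! ### The normals of a planar element -/

/-- A closed polygonal chain of four reals `a, b, c, e` has total variation at most twice its
range, provided that a convex combination of `a, c` equals one of `b, e`. -/
lemma four_cycle_variation {a b c e α γ R : ℝ} (hα : 0 < α) (hα' : 0 < 1 - α) (hγ : 0 < γ)
    (hγ' : 0 < 1 - γ) (h : α * a + (1 - α) * c = γ * b + (1 - γ) * e)
    (hab : |a - b| ≤ R) (hbc : |b - c| ≤ R) (hce : |c - e| ≤ R) (hea : |e - a| ≤ R)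
    (hac : |a - c| ≤ R) (hbe : |b - e| ≤ R) :
    |a - b| + |b - c| + |c - e| + |e - a| ≤ 2 * R := by
  have hR : 0 ≤ R := (abs_nonneg _).trans hab
  have key : ∀ {a b c e α γ : ℝ}, 0 < α → 0 < 1 - α → 0 < γ → 0 < 1 - γ →
      α * a + (1 - α) * c = γ * b + (1 - γ) * e → b ≤ a → b ≤ c → e ≤ c → e ≤ a →
      a = b ∧ c = b ∧ e = b := by
    intro a b c e α γ hα hα' hγ hγ' h h1 h2 h3 h4
    -- the combination is a sum of four nonnegative multiples of the differences
    have p1 := mul_nonneg (mul_pos hα hγ).le (sub_nonneg.2 h1)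
    have p2 := mul_nonneg (mul_pos hα hγ').le (sub_nonneg.2 h4)
    have p3 := mul_nonneg (mul_pos hα' hγ).le (sub_nonneg.2 h2)
    have p4 := mul_nonneg (mul_pos hα' hγ').le (sub_nonneg.2 h3)
    have hs : α * γ * (a - b) + α * (1 - γ) * (a - e) + (1 - α) * γ * (c - b) +
        (1 - α) * (1 - γ) * (c - e) = 0 := by linear_combination h
    have q1 : α * γ * (a - b) = 0 := by linarith
    have q2 : α * (1 - γ) * (a - e) = 0 := by linarith
    have q3 : (1 - α) * γ * (c - b) = 0 := by linarith
    have r1 := (mul_eq_zero.1 q1).resolve_left (mul_pos hα hγ).ne'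
    have r2 := (mul_eq_zero.1 q2).resolve_left (mul_pos hα hγ').ne'
    have r3 := (mul_eq_zero.1 q3).resolve_left (mul_pos hα' hγ).ne'
    exact ⟨by linarith, by linarith, by linarith⟩
  have l1 := abs_le.1 hac
  have l2 := abs_le.1 hbe
  have l3 := abs_le.1 hab
  have l4 := abs_le.1 hbc
  have l5 := abs_le.1 hce
  have l6 := abs_le.1 hea
  rcases le_total a b with h1 | h1 <;> rcases le_total b c with h2 | h2 <;>
    rcases le_total c e with h3 | h3 <;> rcases le_total e a with h4 | h4 <;>
    simp only [abs_of_nonneg, abs_of_nonpos, sub_nonneg, sub_nonpos, h1, h2, h3, h4] <;>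
    first
    | linarith
    | (have := key hα hα' hγ hγ' h h1 h2 h3 h4; linarith)
    | (have := key hγ hγ' hα hα' h.symm h1 h4 h3 h2; linarith)

namespace Cell

variable {s : Shape}

/-- In the plane, the length of an edge times the component of `G` along its normal is the
increment along the edge of the linear function given by `G` rotated by a right angle. -/
lemma diam_facet_mul_inner_normal (K : Cell s 2) {j : s.Facet 2} {p q : s.Vertex 2}
    (hpq : {i | s.Incident 2 i j} = {p, q}) (G : Space 2) :
    Metric.diam (K.facet j) * |inner ℝ (K.normal j) G| =
      |inner ℝ (!₂[-G 1, G 0] : Space 2) (K.vertex p) -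
        inner ℝ (!₂[-G 1, G 0] : Space 2) (K.vertex q)| := by
  have hp : s.Incident 2 p j := by
    have : p ∈ {i | s.Incident 2 i j} := by rw [hpq]; simp
    exact this
  have hq : s.Incident 2 q j := by
    have : q ∈ {i | s.Incident 2 i j} := by rw [hpq]; simp
    exact this
  rw [facet, convexHull_diam, hpq, Set.image_pair, Metric.diam_pair, dist_eq_norm,
    ← inner_sub_right]
  have h0 : inner ℝ (K.normal j) (K.vertex p - K.vertex q) = 0 := by
    rw [inner_sub_right, K.on_facet _ _ hp, K.on_facet _ _ hq, sub_self]
  have h1 := K.norm_normal j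
  set n := K.normal j
  set e := K.vertex p - K.vertex q
  have hn : n 0 ^ 2 + n 1 ^ 2 = 1 := by
    have := EuclideanSpace.norm_sq_eq (𝕜 := ℝ) n
    rw [h1] at this
    simpa [Fin.sum_univ_two] using this.symm
  have he : ‖e‖ ^ 2 = e 0 ^ 2 + e 1 ^ 2 := by
    simpa [Fin.sum_univ_two] using EuclideanSpace.norm_sq_eq (𝕜 := ℝ) e
  simp only [PiLp.inner_apply, Fin.sum_univ_two, RCLike.inner_apply, conj_trivial] at h0 ⊢
  simp only [Matrix.cons_val_zero, Matrix.cons_val_one]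
  rw [← abs_of_nonneg (norm_nonneg e), ← abs_mul, ← sq_eq_sq_iff_abs_eq_abs, mul_pow, he]
  have e0 : e 0 = -n 1 * (n 0 * e 1 - n 1 * e 0) := by
    linear_combination (-e 0) * hn + n 0 * h0
  have e1 : e 1 = n 0 * (n 0 * e 1 - n 1 * e 0) := by
    linear_combination (-e 1) * hn + n 1 * h0
  generalize n 0 * e 1 - n 1 * e 0 = t at e0 e1
  rw [e0, e1]
  linear_combination (t ^ 2 * (G 0 * n 0 + G 1 * n 1) ^ 2) * hn

lemma norm_rot (G : Space 2) : ‖(!₂[-G 1, G 0] : Space 2)‖ = ‖G‖ := by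
  rw [EuclideanSpace.norm_eq, EuclideanSpace.norm_eq]
  simp [Fin.sum_univ_two, add_comm]

/-- The vertices of a convex quadrilateral satisfy an affine relation in which opposite vertices
stand on the same side: the diagonals intersect. -/
lemma exists_diagonal_relation (K : Cell .cuboid 2) : ∃ α γ : ℝ, 0 < α ∧ 0 < 1 - α ∧ 0 < γ ∧
    0 < 1 - γ ∧
    α • K.vertex (![false, false] : Fin 2 → Bool) +
        (1 - α) • K.vertex (![true, true] : Fin 2 → Bool) =
      γ • K.vertex (![true, false] : Fin 2 → Bool) +
        (1 - γ) • K.vertex (![false, true] : Fin 2 → Bool) := by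
  let V : Bool × Bool → Space 2 := fun i => K.vertex (![i.1, i.2] : Fin 2 → Bool)
  -- four vectors `(v_i, 1)` in a three-dimensional space are linearly dependent
  let Φ : (Bool × Bool → ℝ) →ₗ[ℝ] Space 2 × ℝ :=
    Fintype.linearCombination ℝ (fun i => (V i, (1 : ℝ)))
  have hker : LinearMap.ker Φ ≠ ⊥ := LinearMap.ker_ne_bot_of_finrank_lt (by simp)
  obtain ⟨c, hc, hc0⟩ := (Submodule.ne_bot_iff _).1 hker
  have hΦ : Φ c = 0 := hc
  simp only [Φ, Fintype.linearCombination_apply, Fintype.sum_prod_type, Fintype.sum_bool,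
    Prod.smul_mk, Prod.mk_add_mk, Prod.mk_eq_zero, smul_eq_mul, mul_one] at hΦ
  obtain ⟨hv, hs⟩ := hΦ
  -- the distance to the line through one edge kills the two vertices of that edge
  have gap : ∀ (k : Fin 2) (b : Bool) (i : Bool × Bool), (![i.1, i.2] : Fin 2 → Bool) k ≠ b →
      0 < K.offset (k, b) - inner ℝ (K.normal (k, b)) (V i) := fun k b i hi =>
    sub_pos.2 (K.off_facet _ _ hi)
  have on : ∀ (k : Fin 2) (b : Bool) (i : Bool × Bool), (![i.1, i.2] : Fin 2 → Bool) k = b →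
      inner ℝ (K.normal (k, b)) (V i) = K.offset (k, b) := fun k b i hi => K.on_facet _ _ hi
  have rel : ∀ (k : Fin 2) (b : Bool),
      c (true, true) * inner ℝ (K.normal (k, b)) (V (true, true)) +
      c (true, false) * inner ℝ (K.normal (k, b)) (V (true, false)) +
      (c (false, true) * inner ℝ (K.normal (k, b)) (V (false, true)) +
      c (false, false) * inner ℝ (K.normal (k, b)) (V (false, false))) = 0 := by
    intro k b
    have := congrArg (fun y => inner ℝ (K.normal (k, b)) y) hv
    simpa only [inner_add_right, inner_smul_right, inner_zero_right] using this
  have alt : ∀ {x y g h : ℝ}, 0 < g → 0 < h → x * g + y * h = 0 → (0 < x → y < 0) ∧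
      (x < 0 → 0 < y) ∧ (x = 0 → y = 0) := by
    intro x y g h hg hh hxy
    refine ⟨fun hx => ?_, fun hx => ?_, fun hx => ?_⟩
    · by_contra! hy; nlinarith [mul_pos hx hg, mul_nonneg hy hh.le]
    · by_contra! hy; nlinarith [mul_neg_of_neg_of_pos hx hg, mul_nonneg (neg_nonneg.2 hy) hh.le]
    · subst hx; rw [zero_mul, zero_add] at hxy; exact (mul_eq_zero.1 hxy).resolve_right hh.ne'
  -- so the coefficients of the two vertices opposite to each edge have opposite signs
  have a1 := alt (gap 0 true (false, false) (by simp)) (gap 0 true (false, true) (by simp))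
    (x := c (false, false)) (y := c (false, true)) (by
      have := rel 0 true
      rw [on 0 true (true, true) (by simp), on 0 true (true, false) (by simp)] at this
      linear_combination K.offset ((0 : Fin 2), true) * hs - this)
  have a2 := alt (gap 1 true (false, false) (by simp)) (gap 1 true (true, false) (by simp))
    (x := c (false, false)) (y := c (true, false)) (by
      have := rel 1 true
      rw [on 1 true (true, true) (by simp), on 1 true (false, true) (by simp)] at this
      linear_combination K.offset ((1 : Fin 2), true) * hs - this)
  have a3 := alt (gap 1 false (false, true) (by simp)) (gap 1 false (true, true) (by simp))
    (x := c (false, true)) (y := c (true, true)) (by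
      have := rel 1 false
      rw [on 1 false (true, false) (by simp), on 1 false (false, false) (by simp)] at this
      linear_combination K.offset ((1 : Fin 2), false) * hs - this)
  have main : ∀ {c₀₀ c₀₁ c₁₀ c₁₁ : ℝ},
      c₁₁ • V (true, true) + c₁₀ • V (true, false) +
        (c₀₁ • V (false, true) + c₀₀ • V (false, false)) = 0 →
      c₁₁ + c₁₀ + (c₀₁ + c₀₀) = 0 → 0 < c₀₀ → c₀₁ < 0 → c₁₀ < 0 → 0 < c₁₁ →
      ∃ α γ : ℝ, 0 < α ∧ 0 < 1 - α ∧ 0 < γ ∧ 0 < 1 - γ ∧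
        α • V (false, false) + (1 - α) • V (true, true) =
          γ • V (true, false) + (1 - γ) • V (false, true) := by
    intro c₀₀ c₀₁ c₁₀ c₁₁ hv hs h00 h01 h10 h11
    have hpos : 0 < c₀₀ + c₁₁ := by linarith
    have e1 : 1 - c₀₀ / (c₀₀ + c₁₁) = c₁₁ / (c₀₀ + c₁₁) := by field_simp; ring
    have e2 : 1 - -c₁₀ / (c₀₀ + c₁₁) = -c₀₁ / (c₀₀ + c₁₁) := by
      field_simp; linarith
    refine ⟨c₀₀ / (c₀₀ + c₁₁), -c₁₀ / (c₀₀ + c₁₁), div_pos h00 hpos, ?_,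
      div_pos (by linarith) hpos, ?_, ?_⟩
    · rw [e1]; exact div_pos h11 hpos
    · rw [e2]; exact div_pos (by linarith) hpos
    · rw [e1, e2, ← sub_eq_zero]
      have : (c₀₀ + c₁₁)⁻¹ • (c₁₁ • V (true, true) + c₁₀ • V (true, false) +
        (c₀₁ • V (false, true) + c₀₀ • V (false, false))) = 0 := by rw [hv, smul_zero]
      rw [← this]
      simp only [div_eq_inv_mul]
      module
  rcases lt_trichotomy (c (false, false)) 0 with h | h | h
  · have hv' : (-c (true, true)) • V (true, true) + (-c (true, false)) • V (true, false) +
        ((-c (false, true)) • V (false, true) + (-c (false, false)) • V (false, false)) = 0 := by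
      rw [← neg_eq_zero, ← hv]; module
    refine main hv' (by linarith) (by linarith) ?_ ?_ ?_
    · linarith [a1.2.1 h]
    · linarith [a2.2.1 h]
    · linarith [a3.1 (a1.2.1 h)]
  · exact absurd (by
      funext ⟨i, j⟩
      have h1 := a1.2.2 h
      have h2 := a2.2.2 h
      have h3 := a3.2.2 h1
      cases i <;> cases j <;> simpa) hc0
  · exact main hv hs h (a1.1 h) (a2.1 h) (a3.2.1 (a1.1 h))

/-- In the plane, `∑_e h_e (n_e · G)² ≤ 2 h_K |G|²`: the projection of the convex boundary onto a
line covers its image twice. -/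
lemma sum_diam_mul_sq_inner_normal_le (K : Cell s 2) (G : Space 2) :
    ∑ j, Metric.diam (K.facet j) * inner ℝ (K.normal j) G ^ 2 ≤
      2 * Metric.diam K.carrier * ‖G‖ ^ 2 := by
  set T : Space 2 := !₂[-G 1, G 0] with hT
  have hTG : ‖T‖ = ‖G‖ := norm_rot G
  set R := ‖G‖ * Metric.diam K.carrier with hR
  set f : s.Vertex 2 → ℝ := fun i => inner ℝ T (K.vertex i) with hf
  have hfR : ∀ p q, |f p - f q| ≤ R := by
    intro p q
    simp only [hf, hR, ← hTG]
    rw [← inner_sub_right]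
    refine (abs_real_inner_le_norm _ _).trans (mul_le_mul_of_nonneg_left ?_ (norm_nonneg _))
    rw [← dist_eq_norm]
    exact Metric.dist_le_diam_of_mem K.isCompact_carrier.isBounded
      (subset_convexHull ℝ _ (Set.mem_range_self _)) (subset_convexHull ℝ _ (Set.mem_range_self _))
  have hterm : ∀ (j : s.Facet 2) (p q : s.Vertex 2), {i | s.Incident 2 i j} = {p, q} →
      Metric.diam (K.facet j) * inner ℝ (K.normal j) G ^ 2 ≤ |f p - f q| * ‖G‖ := by
    intro j p q hpq
    have h1 := K.diam_facet_mul_inner_normal hpq G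
    have h2 : |inner ℝ (K.normal j) G| ≤ ‖G‖ := by
      simpa [K.norm_normal] using abs_real_inner_le_norm (K.normal j) G
    calc _ = Metric.diam (K.facet j) * |inner ℝ (K.normal j) G| * |inner ℝ (K.normal j) G| := by
          rw [← sq_abs]; ring
      _ ≤ _ := by
          rw [h1]
          exact mul_le_mul_of_nonneg_left h2 (abs_nonneg _)
  suffices h : ∃ t : s.Facet 2 → ℝ,
      (∀ j, Metric.diam (K.facet j) * inner ℝ (K.normal j) G ^ 2 ≤ t j * ‖G‖) ∧
      ∑ j, t j ≤ 2 * R by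
    obtain ⟨t, h1, h2⟩ := h
    calc _ ≤ ∑ j, t j * ‖G‖ := Finset.sum_le_sum fun j _ => h1 j
      _ ≤ 2 * R * ‖G‖ := by
          rw [← Finset.sum_mul]
          exact mul_le_mul_of_nonneg_right h2 (norm_nonneg _)
      _ = _ := by rw [hR]; ring
  cases s with
  | simplex =>
    let f' : Fin 3 → ℝ := f
    have hfR' : ∀ p q, |f' p - f' q| ≤ R := hfR
    refine ⟨(![|f' 1 - f' 2|, |f' 0 - f' 2|, |f' 0 - f' 1|] : Fin 3 → ℝ), ?_, ?_⟩
    · change ∀ j : Fin 3, _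
      intro j
      fin_cases j
      · exact hterm _ (1 : Fin 3) (2 : Fin 3) (by
          change {i : Fin 3 | i ≠ 0} = {1, 2}; ext i; fin_cases i <;> simp)
      · exact hterm _ (0 : Fin 3) (2 : Fin 3) (by
          change {i : Fin 3 | i ≠ 1} = {0, 2}; ext i; fin_cases i <;> simp)
      · exact hterm _ (0 : Fin 3) (1 : Fin 3) (by
          change {i : Fin 3 | i ≠ 2} = {0, 1}; ext i; fin_cases i <;> simp)
    · change ∑ j : Fin 3, _ ≤ _
      simp only [Fin.sum_univ_three, Matrix.cons_val]
      have h1 := abs_le.1 (hfR' 1 2)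
      have h2 := abs_le.1 (hfR' 0 2)
      have h3 := abs_le.1 (hfR' 0 1)
      rcases abs_cases (f' 1 - f' 2) with ⟨e1, _⟩ | ⟨e1, _⟩ <;>
        rcases abs_cases (f' 0 - f' 2) with ⟨e2, _⟩ | ⟨e2, _⟩ <;>
        rcases abs_cases (f' 0 - f' 1) with ⟨e3, _⟩ | ⟨e3, _⟩ <;>
        rw [e1, e2, e3] <;> linarith
  | cuboid =>
    let g : Bool → Bool → ℝ := fun a b => f (![a, b] : Fin 2 → Bool)
    have hgR : ∀ a b a' b', |g a b - g a' b'| ≤ R := fun _ _ _ _ => hfR _ _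
    obtain ⟨α, γ, hα, hα', hγ, hγ', hrel⟩ := K.exists_diagonal_relation
    have hrel' : α * g false false + (1 - α) * g true true =
        γ * g true false + (1 - γ) * g false true := by
      have := congrArg (fun y => inner ℝ T y) hrel
      simpa only [inner_add_right, inner_smul_right] using this
    let t : Fin 2 × Bool → ℝ := fun j =>
      (![|g j.2 false - g j.2 true|, |g false j.2 - g true j.2|] : Fin 2 → ℝ) j.1
    refine ⟨t, ?_, ?_⟩
    · change ∀ j : Fin 2 × Bool, _
      rintro ⟨k, b⟩
      have hfun : ∀ i : Fin 2 → Bool, i = ![i 0, i 1] := fun i => by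
        ext k; fin_cases k <;> rfl
      fin_cases k
      · refine hterm _ (![b, false] : Fin 2 → Bool) (![b, true] : Fin 2 → Bool) ?_
        change {i : Fin 2 → Bool | i 0 = b} = {![b, false], ![b, true]}
        ext i
        rw [hfun i]
        generalize i 0 = a0
        generalize i 1 = a1
        cases a0 <;> cases a1 <;> cases b <;> simp
      · refine hterm _ (![false, b] : Fin 2 → Bool) (![true, b] : Fin 2 → Bool) ?_
        change {i : Fin 2 → Bool | i 1 = b} = {![false, b], ![true, b]}
        ext i
        rw [hfun i]
        generalize i 0 = a0
        generalize i 1 = a1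
        cases a0 <;> cases a1 <;> cases b <;> simp
    · change ∑ j : Fin 2 × Bool, t j ≤ _
      simp only [t, Fintype.sum_prod_type, Fin.sum_univ_two, Fintype.sum_bool, Matrix.cons_val]
      have := four_cycle_variation hα hα' hγ hγ' hrel' (hgR _ _ _ _) (hgR _ _ _ _) (hgR _ _ _ _)
        (hgR _ _ _ _) (hgR _ _ _ _) (hgR _ _ _ _)
      rw [abs_sub_comm (g false true) (g false false)] at this
      rw [abs_sub_comm (g false true) (g true true)]
      linarith

end Cell

/-! ### The local polynomial spaces -/

section Polynomials

variable {d : ℕ}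

/-- The monomial `x^m` in the Cartesian coordinates. -/
def monomialFun (m : Fin d → ℕ) : Space d → ℝ := fun x => ∏ i, x i ^ m i

lemma analyticOnNhd_monomialFun (m : Fin d → ℕ) : AnalyticOnNhd ℝ (monomialFun m) Set.univ := by
  unfold monomialFun
  refine Finset.analyticOnNhd_fun_prod _ fun i _ => AnalyticOnNhd.pow ?_ _
  exact (EuclideanSpace.proj (𝕜 := ℝ) i).analyticOnNhd _

/-- The exponents of the monomials that span the local space. -/
def exponents : (s : Shape) → (d : ℕ) → Set (Fin d → ℕ)
  | .simplex, _ => {m | ∑ i, m i ≤ 1}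
  | .cuboid, _ => {m | ∀ i, m i ≤ 1}

variable {s : Shape}

lemma le_one_of_mem_exponents {m : Fin d → ℕ} (hm : m ∈ exponents s d) (i : Fin d) : m i ≤ 1 := by
  cases s with
  | simplex =>
    exact (Finset.single_le_sum (f := m) (fun _ _ => Nat.zero_le _) (Finset.mem_univ i)).trans hm
  | cuboid => exact hm i

lemma mem_exponents_of_le {m m' : Fin d → ℕ} (hm : m ∈ exponents s d) (h : m' ≤ m) :
    m' ∈ exponents s d := by
  cases s with
  | simplex => exact (Finset.sum_le_sum fun i _ => h i).trans hm
  | cuboid => exact fun i => (h i).trans (hm i)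

lemma finite_exponents : (exponents s d).Finite :=
  (Set.finite_Iic (fun _ => 1 : Fin d → ℕ)).subset fun _ hm i => le_one_of_mem_exponents hm i

lemma localSpace_eq_span : localSpace s d = Submodule.span ℝ (monomialFun '' exponents s d) := by
  cases s with
  | simplex =>
    change Submodule.span ℝ _ = _
    congr 1; ext f; constructor
    · rintro ⟨m, hm, rfl⟩; exact ⟨m, hm, rfl⟩
    · rintro ⟨m, hm, rfl⟩; exact ⟨m, hm, rfl⟩
  | cuboid =>
    change boxPoly (fun _ => 1) = _
    unfold boxPoly
    congr 1; ext f; constructor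
    · rintro ⟨m, hm, rfl⟩; exact ⟨m, hm, rfl⟩
    · rintro ⟨m, hm, rfl⟩; exact ⟨m, hm, rfl⟩

instance instFiniteDimensionalLocalSpace (s : Shape) (d : ℕ) :
    FiniteDimensional ℝ (localSpace s d) := by
  rw [localSpace_eq_span]
  exact FiniteDimensional.span_of_finite ℝ (finite_exponents.image _)

lemma monomialFun_mem_localSpace {m : Fin d → ℕ} (hm : m ∈ exponents s d) :
    monomialFun m ∈ localSpace s d := by
  rw [localSpace_eq_span]; exact Submodule.subset_span ⟨m, hm, rfl⟩

lemma const_mem_localSpace (c : ℝ) : (fun _ => c) ∈ localSpace s d := by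
  have h : (0 : Fin d → ℕ) ∈ exponents s d := by cases s <;> simp [exponents]
  have := (localSpace s d).smul_mem c (monomialFun_mem_localSpace h)
  convert this using 1
  funext x
  simp [monomialFun]

lemma coord_mem_localSpace (i : Fin d) : (fun x : Space d => x i) ∈ localSpace s d := by
  have h : (Pi.single i 1 : Fin d → ℕ) ∈ exponents s d := by
    cases s
    · simp [exponents]
    · intro k
      by_cases hk : k = i
      · subst hk; simp
      · simp [hk]
  convert monomialFun_mem_localSpace h using 1
  funext x
  rw [monomialFun, Finset.prod_eq_single i]
  · simp
  · intro k _ hk; simp [hk]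
  · simp

lemma affine_mem_localSpace (a : ℝ) (n : Space d) :
    (fun x : Space d => a + inner ℝ n x) ∈ localSpace s d := by
  have : (fun x : Space d => a + inner ℝ n x) =
      (fun _ => a) + ∑ i, n i • (fun x : Space d => x i) := by
    funext x
    simp [PiLp.inner_apply, mul_comm]
  rw [this]
  exact add_mem (const_mem_localSpace a)
    (Submodule.sum_mem _ fun i _ => Submodule.smul_mem _ _ (coord_mem_localSpace i))

lemma analyticOnNhd_of_mem_localSpace {f : Space d → ℝ} (hf : f ∈ localSpace s d) :
    AnalyticOnNhd ℝ f Set.univ := by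
  rw [localSpace_eq_span] at hf
  induction hf using Submodule.span_induction with
  | zero => exact analyticOnNhd_const
  | add a b _ _ ha hb => exact ha.add hb
  | smul r a _ ha => exact (analyticOnNhd_const (v := r)).smul ha
  | mem y hy => obtain ⟨m, -, rfl⟩ := hy; exact analyticOnNhd_monomialFun m

lemma contDiff_of_mem_localSpace {f : Space d → ℝ} (hf : f ∈ localSpace s d) : ContDiff ℝ 1 f :=
  contDiffOn_univ.1 ((analyticOnNhd_of_mem_localSpace hf).contDiffOn uniqueDiffOn_univ)

lemma differentiable_of_mem_localSpace {f : Space d → ℝ} (hf : f ∈ localSpace s d) :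
    Differentiable ℝ f := (contDiff_of_mem_localSpace hf).differentiable one_ne_zero

lemma continuous_of_mem_localSpace {f : Space d → ℝ} (hf : f ∈ localSpace s d) : Continuous f :=
  (differentiable_of_mem_localSpace hf).continuous

lemma continuous_gradient_of_mem_localSpace {f : Space d → ℝ} (hf : f ∈ localSpace s d) :
    Continuous (gradient f) :=
  (InnerProductSpace.toDual ℝ (Space d)).symm.continuous.comp
    ((contDiff_of_mem_localSpace hf).continuous_fderiv one_ne_zero)

/-- A polynomial that vanishes on a nonempty open set is zero. -/
lemma eq_zero_of_mem_localSpace {f : Space d → ℝ} (hf : f ∈ localSpace s d) {U : Set (Space d)}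
    (hU : IsOpen U) (hne : U.Nonempty) (h : ∀ x ∈ U, f x = 0) : f = 0 := by
  obtain ⟨x, hx⟩ := hne
  refine (analyticOnNhd_of_mem_localSpace hf).eq_of_eventuallyEq (z₀ := x) analyticOnNhd_const ?_
  filter_upwards [hU.mem_nhds hx] with y hy using h y hy

lemma gradient_add_of_differentiable {f g : Space d → ℝ} (hf : Differentiable ℝ f)
    (hg : Differentiable ℝ g) : gradient (f + g) = gradient f + gradient g := by
  funext x
  simp [gradient, fderiv_add (hf x) (hg x)]

lemma gradient_const_smul_of_differentiable {f : Space d → ℝ} (hf : Differentiable ℝ f) (c : ℝ) :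
    gradient (c • f) = c • gradient f := by
  funext x
  simp [gradient, fderiv_const_smul (hf x) c]

lemma inner_gradient_monomialFun {m : Fin d → ℕ} (hm : ∀ i, m i ≤ 1) (n x : Space d) :
    inner ℝ n (gradient (monomialFun m) x) =
      ∑ i, (m i * n i) * monomialFun (Function.update m i 0) x := by
  rw [real_inner_comm, inner_gradient_left]
  have h := HasFDerivAt.finsetProd (u := Finset.univ) (x := x)
    (g := fun (i : Fin d) (x : Space d) => x i ^ m i)
    (fun i _ => ((EuclideanSpace.proj (𝕜 := ℝ) i).hasFDerivAt (x := x)).pow (m i))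
  have h' := h.fderiv
  change fderiv ℝ (fun x : Space d => ∏ i, x i ^ m i) x n = _
  rw [h']
  simp only [sum_apply, smul_apply, smul_eq_mul]
  refine Finset.sum_congr rfl fun i _ => ?_
  have h0 : x i ^ (m i - 1) = 1 := by
    rw [Nat.sub_eq_zero_of_le (hm i), pow_zero]
  have h1 : monomialFun (Function.update m i 0) x = ∏ j ∈ Finset.univ.erase i, x j ^ m j := by
    unfold monomialFun
    rw [← Finset.mul_prod_erase _ _ (Finset.mem_univ i)]
    simp only [Function.update_self, pow_zero, one_mul]
    refine Finset.prod_congr rfl fun j hj => ?_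
    rw [Function.update_of_ne (Finset.ne_of_mem_erase hj)]
  rw [h1, mul_comm, PiLp.proj_apply, h0, nsmul_eq_mul, mul_one, PiLp.proj_apply]

/-- The components of the gradient stay in the local space, in every direction. -/
lemma inner_gradient_mem_localSpace {f : Space d → ℝ} (hf : f ∈ localSpace s d) (n : Space d) :
    (fun x => inner ℝ n (gradient f x)) ∈ localSpace s d := by
  have hf' := hf
  rw [localSpace_eq_span] at hf'
  induction hf' using Submodule.span_induction with
  | zero =>
    convert (localSpace s d).zero_mem using 1
    funext x
    simp [gradient]
  | add a b ha hb iha ihb =>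
    rw [← localSpace_eq_span] at ha hb
    convert add_mem (iha ha) (ihb hb) using 1
    funext x
    rw [gradient_add_of_differentiable (differentiable_of_mem_localSpace ha)
      (differentiable_of_mem_localSpace hb)]
    simp [inner_add_right]
  | smul r a ha iha =>
    rw [← localSpace_eq_span] at ha
    convert Submodule.smul_mem _ r (iha ha) using 1
    funext x
    rw [gradient_const_smul_of_differentiable (differentiable_of_mem_localSpace ha)]
    simp [inner_smul_right]
  | mem y hy =>
    obtain ⟨m, hm, rfl⟩ := hy
    have : (fun x => inner ℝ n (gradient (monomialFun m) x)) =
        ∑ i, (m i * n i) • monomialFun (Function.update m i 0) := by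
      funext x
      rw [inner_gradient_monomialFun (le_one_of_mem_exponents hm)]
      simp
    rw [this]
    refine Submodule.sum_mem _ fun i _ => Submodule.smul_mem _ _ (monomialFun_mem_localSpace
      (mem_exponents_of_le hm fun k => ?_))
    by_cases hk : k = i
    · subst hk; simp
    · rw [Function.update_of_ne hk]

/-- Polynomials in `P_1` have constant gradients. -/
lemma exists_gradient_eq_const {f : Space d → ℝ} (hf : f ∈ localSpace .simplex d) :
    ∃ G, ∀ x, gradient f x = G := by
  suffices h : ∀ n x, inner ℝ n (gradient f x) = inner ℝ n (gradient f 0) from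
    ⟨gradient f 0, fun x => ext_inner_left ℝ fun n => h n x⟩
  intro n x
  have hf' := hf
  rw [localSpace_eq_span] at hf'
  induction hf' using Submodule.span_induction with
  | zero => simp [gradient]
  | add a b ha hb iha ihb =>
    rw [← localSpace_eq_span] at ha hb
    rw [gradient_add_of_differentiable (differentiable_of_mem_localSpace ha)
      (differentiable_of_mem_localSpace hb)]
    simp only [Pi.add_apply, inner_add_right, iha ha, ihb hb]
  | smul r a ha iha =>
    rw [← localSpace_eq_span] at ha
    rw [gradient_const_smul_of_differentiable (differentiable_of_mem_localSpace ha)]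
    simp only [Pi.smul_apply, inner_smul_right, iha ha]
  | mem y hy =>
    obtain ⟨m, hm, rfl⟩ := hy
    rw [inner_gradient_monomialFun (le_one_of_mem_exponents hm),
      inner_gradient_monomialFun (le_one_of_mem_exponents hm)]
    refine Finset.sum_congr rfl fun i _ => ?_
    by_cases hi : m i = 0
    · simp [hi]
    · have h0 : Function.update m i 0 = 0 := by
        have hm' : ∑ k, m k ≤ 1 := hm
        funext k
        by_cases hk : k = i
        · subst hk; simp
        · rw [Function.update_of_ne hk]
          have := Finset.add_le_sum (f := m) (s := Finset.univ) (fun _ _ => Nat.zero_le _)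
            (Finset.mem_univ i) (Finset.mem_univ k) (Ne.symm hk)
          simp only [Pi.zero_apply]
          omega
      simp [h0, monomialFun]

lemma continuous_of_mem_boxPoly {k : Fin d → ℕ} {f : Space d → ℝ} (hf : f ∈ boxPoly k) :
    Continuous f := by
  unfold boxPoly at hf
  induction hf using Submodule.span_induction with
  | zero => exact continuous_const
  | add a b _ _ ha hb => exact ha.add hb
  | smul r a _ ha => exact ha.const_smul r
  | mem y hy =>
    obtain ⟨m, -, rfl⟩ := hy
    fun_prop

lemma IsLocalRT.continuous {u : Space d → Space d} (hu : IsLocalRT s u) : Continuous u := by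
  cases s with
  | simplex => obtain ⟨a, b, rfl⟩ := hu; fun_prop
  | cuboid =>
    have h : Continuous fun x i => u x i := continuous_pi fun i => continuous_of_mem_boxPoly (hu i)
    exact (PiLp.continuous_toLp 2 _).comp h

end Polynomials

/-! ### Moments of a barycentric coordinate -/

namespace Cell

variable {d : ℕ}

/-- The barycentric coordinate of a simplex that belongs to the vertex opposite to the facet `j`. -/
def baryCoord (K : Cell .simplex d) (j : Fin (d + 1)) (x : Space d) : ℝ :=
  (K.offset j - inner ℝ (K.normal j) x) / (K.offset j - inner ℝ (K.normal j) (K.vertex j))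

lemma offset_sub_pos (K : Cell .simplex d) (j : Fin (d + 1)) :
    0 < K.offset j - inner ℝ (K.normal j) (K.vertex j) :=
  sub_pos.2 (K.off_facet j j fun h => h rfl)

lemma baryCoord_of_mem_facet (K : Cell .simplex d) (j : Fin (d + 1)) {x : Space d}
    (hx : x ∈ K.facet j) : K.baryCoord j x = 0 := by
  rw [baryCoord, K.inner_normal_of_mem_facet hx, sub_self, zero_div]

lemma baryCoord_convexCombination (K : Cell .simplex d) (j : Fin (d + 1)) (x : Space d) (a : ℝ) :
    K.baryCoord j (a • K.vertex j + (1 - a) • x) = a + (1 - a) * K.baryCoord j x := by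
  have := (K.offset_sub_pos j).ne'
  unfold baryCoord
  rw [inner_add_right, inner_smul_right, inner_smul_right]
  field_simp
  ring

lemma continuous_baryCoord (K : Cell .simplex d) (j : Fin (d + 1)) :
    Continuous (K.baryCoord j) := by
  unfold baryCoord
  fun_prop

lemma exists_eq_convexCombination (K : Cell .simplex d) (hd : 0 < d) (j : Fin (d + 1))
    {y : Space d} (hy : y ∈ K.carrier) : ∃ z ∈ K.facet j, 0 ≤ K.baryCoord j y ∧
      K.baryCoord j y ≤ 1 ∧
      y = K.baryCoord j y • K.vertex j + (1 - K.baryCoord j y) • z := by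
  have hrange : Set.range K.vertex =
      insert (K.vertex j) (K.vertex '' {i : Fin (d + 1) | i ≠ j}) := by
    ext p; constructor
    · rintro ⟨i, rfl⟩
      by_cases h : i = j
      · left; rw [h]
      · right; exact ⟨i, h, rfl⟩
    · rintro (rfl | ⟨i, -, rfl⟩)
      · exact ⟨_, rfl⟩
      · exact ⟨i, rfl⟩
  have hne : (K.vertex '' {i : Fin (d + 1) | i ≠ j}).Nonempty := by
    have : Nontrivial (Fin (d + 1)) := Fin.nontrivial_iff_two_le.2 (by omega)
    obtain ⟨i, hi⟩ := exists_ne j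
    exact ⟨_, i, hi, rfl⟩
  rw [carrier, hrange, convexHull_insert hne, mem_convexJoin] at hy
  obtain ⟨v, rfl, z, hz, a, b, ha, hb, hab, rfl⟩ := hy
  obtain rfl : b = 1 - a := by linarith
  have hz' : z ∈ K.facet j := hz
  have hval : K.baryCoord j (a • K.vertex j + (1 - a) • z) = a := by
    rw [baryCoord_convexCombination, K.baryCoord_of_mem_facet j hz', mul_zero, add_zero]
  rw [hval]
  exact ⟨z, hz', ha, by linarith, rfl⟩

/-- The part of a simplex where a barycentric coordinate is at least `t` is a copy of the simplex,
scaled by `1 - t`. -/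
lemma superlevel_baryCoord (K : Cell .simplex d) (hd : 0 < d) (j : Fin (d + 1)) {t : ℝ}
    (ht : 0 ≤ t) (ht' : t ≤ 1) : {x | t ≤ K.baryCoord j x} ∩ K.carrier =
      AffineMap.homothety (K.vertex j) (1 - t) '' K.carrier := by
  have hconv : Convex ℝ K.carrier := convex_convexHull ℝ _
  have hv : K.vertex j ∈ K.carrier := subset_convexHull ℝ _ (Set.mem_range_self _)
  have hom : ∀ x, AffineMap.homothety (K.vertex j) (1 - t) x =
      t • K.vertex j + (1 - t) • x := fun x => by
    rw [AffineMap.homothety_apply, vsub_eq_sub, vadd_eq_add]; module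
  ext y
  constructor
  · rintro ⟨hty, hy⟩
    obtain ⟨z, hz, h0, h1, hyz⟩ := K.exists_eq_convexCombination hd j hy
    have hty' : t ≤ K.baryCoord j y := hty
    generalize K.baryCoord j y = a at hty' h0 h1 hyz
    rcases h1.eq_or_lt with rfl | h1
    · refine ⟨K.vertex j, hv, ?_⟩
      rw [hom, hyz]; module
    · have hpos : 0 < 1 - t := by linarith
      refine ⟨((a - t) / (1 - t)) • K.vertex j + ((1 - a) / (1 - t)) • z,
        hconv hv (K.facet_subset_carrier j hz) (div_nonneg (by linarith) hpos.le)
          (div_nonneg (by linarith) hpos.le) (by field_simp; ring), ?_⟩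
      rw [hom, smul_add, smul_smul, smul_smul, mul_div_cancel₀ _ hpos.ne',
        mul_div_cancel₀ _ hpos.ne', hyz]
      module
  · rintro ⟨x, hx, rfl⟩
    obtain ⟨-, -, h0, -⟩ := K.exists_eq_convexCombination hd j hx
    rw [hom]
    refine ⟨?_, hconv hv hx ht (by linarith) (by ring)⟩
    change t ≤ K.baryCoord j _
    rw [baryCoord_convexCombination]
    nlinarith

lemma measureReal_superlevel_baryCoord (K : Cell .simplex d) (hd : 0 < d) (j : Fin (d + 1)) {t : ℝ}
    (ht : 0 ≤ t) (ht' : t ≤ 1) :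
    (volume.restrict K.carrier).real {x | t ≤ K.baryCoord j x} =
      (1 - t) ^ d * volume.real K.carrier := by
  have hmeas : MeasurableSet {x | t ≤ K.baryCoord j x} :=
    (isClosed_le continuous_const (K.continuous_baryCoord j)).measurableSet
  rw [measureReal_restrict_apply hmeas, K.superlevel_baryCoord hd j ht ht', measureReal_def,
    Measure.addHaar_image_homothety, ENNReal.toReal_mul, measureReal_def,
    ENNReal.toReal_ofReal (abs_nonneg _), finrank_euclideanSpace_fin,
    abs_of_nonneg (pow_nonneg (by linarith) _)]

/-- On a tetrahedron the affine function `1 - 2 λ_j`, which equals `1` on the face `j`, has mean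
square at most `1/2` (the exact value is `2/5`). This is what the trace inequality gains over its
use with the constant `1`. -/
lemma integral_sq_one_sub_two_baryCoord_le (K : Cell .simplex 3) (j : Fin 4) :
    ∫ x in K.carrier, (1 - 2 * K.baryCoord j x) ^ 2 ≤ 1 / 2 * volume.real K.carrier := by
  set l := K.baryCoord j with hl
  set V := volume.real K.carrier with hV
  have hcont : Continuous l := K.continuous_baryCoord j
  have hint : ∀ {f : Space 3 → ℝ}, Continuous f → IntegrableOn f K.carrier := fun hf =>
    hf.continuousOn.integrableOn_compact K.isCompact_carrier
  have hmem : ∀ᵐ x ∂(volume.restrict K.carrier), 0 ≤ l x ∧ l x ≤ 1 := by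
    filter_upwards [ae_restrict_mem K.isCompact_carrier.measurableSet] with x hx
    obtain ⟨-, -, h0, h1, -⟩ := K.exists_eq_convexCombination (by norm_num) j hx
    exact ⟨h0, h1⟩
  -- both moments by the layer cake formula, with superlevel sets of measure `(1 - t)³ V`
  have hm1 : ∫ x in K.carrier, l x = 1 / 4 * V := by
    rw [Integrable.integral_eq_integral_Ioc_meas_le (M := 1) (hint hcont)
      (hmem.mono fun x hx => hx.1) (hmem.mono fun x hx => hx.2)]
    rw [setIntegral_congr_fun (g := fun t : ℝ => (1 - t) ^ 3 * V) measurableSet_Ioc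
      (fun t ht => K.measureReal_superlevel_baryCoord (by norm_num) j ht.1.le ht.2)]
    rw [← intervalIntegral.integral_of_le zero_le_one, intervalIntegral.integral_mul_const,
      intervalIntegral.integral_comp_sub_left (fun t : ℝ => t ^ 3) 1]
    norm_num
  have hm2 : ∫ x in K.carrier, l x ^ 2 = 1 / 10 * V := by
    rw [Integrable.integral_eq_integral_Ioc_meas_le (M := 1) (f := fun x => l x ^ 2)
      (hint (hcont.pow 2))
      (hmem.mono fun x hx => sq_nonneg _) (hmem.mono fun x hx => by
        have := hx.1; have := hx.2; change l x ^ 2 ≤ 1; nlinarith)]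
    rw [setIntegral_congr_fun
      (g := fun t : ℝ => (1 - 3 * t ^ (1 / 2 : ℝ) + 3 * t - t ^ (3 / 2 : ℝ)) * V)
      measurableSet_Ioc]
    · rw [← intervalIntegral.integral_of_le zero_le_one, intervalIntegral.integral_mul_const,
        intervalIntegral.integral_sub, intervalIntegral.integral_add,
        intervalIntegral.integral_sub, intervalIntegral.integral_const_mul,
        intervalIntegral.integral_const_mul, integral_rpow, integral_rpow]
      · norm_num
      all_goals first
        | (left; norm_num)
        | (apply Continuous.intervalIntegrable; fun_prop (disch := norm_num))
    · intro t ht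
      have hs : 0 ≤ √t := Real.sqrt_nonneg t
      have hs1 : √t ≤ 1 := Real.sqrt_le_one.2 ht.2
      have hset : (volume.restrict K.carrier).real {x | t ≤ l x ^ 2} =
          (volume.restrict K.carrier).real {x | √t ≤ l x} := by
        refine measureReal_congr ?_
        filter_upwards [hmem] with x hx
        exact propext (Real.sqrt_le_left hx.1).symm
      change (volume.restrict K.carrier).real {x | t ≤ l x ^ 2} = _
      rw [hset, K.measureReal_superlevel_baryCoord (by norm_num) j hs hs1]
      have h1 : t ^ (1 / 2 : ℝ) = √t := (Real.sqrt_eq_rpow t).symm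
      have h3 : t ^ (3 / 2 : ℝ) = √t ^ 3 := by
        rw [Real.sqrt_eq_rpow, ← Real.rpow_natCast, ← Real.rpow_mul ht.1.le]
        norm_num
      simp only [h1, h3]
      have h2 : t = √t ^ 2 := (Real.sq_sqrt ht.1.le).symm
      nth_rewrite 3 [h2]
      ring
  have hexp : ∫ x in K.carrier, (1 - 2 * l x) ^ 2 =
      (∫ x in K.carrier, (1 : ℝ)) - 4 * (∫ x in K.carrier, l x) +
        4 * ∫ x in K.carrier, l x ^ 2 := by
    rw [← integral_const_mul, ← integral_const_mul, ← integral_sub, ← integral_add]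
    · exact integral_congr_ae (ae_of_all _ fun x => by simp only; ring)
    · exact hint (by fun_prop)
    · exact hint (by fun_prop)
    · exact hint (by fun_prop)
    · exact hint (by fun_prop)
  have h1 : ∫ x in K.carrier, (1 : ℝ) = V := by simp [hV]
  have hV0 : 0 ≤ V := measureReal_nonneg
  rw [hexp, hm1, hm2, h1]
  linarith

end Cell

/-! ### Integrability on cells and facets -/

/-- `f` is measurable, and bounded on `Q`. The coefficients of the scheme need not be continuous, so
that this is what all integrands have in common. -/
structure BoundedMeasurableOn {d : ℕ} (Q : Set (Space d)) (f : Space d → ℝ) : Prop where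
  measurable : Measurable f
  bounded : ∃ C, ∀ x ∈ Q, |f x| ≤ C

namespace BoundedMeasurableOn

variable {d : ℕ} {Q : Set (Space d)} {f g : Space d → ℝ}

lemma of_continuous (hQ : IsCompact Q) (hf : Continuous f) : BoundedMeasurableOn Q f :=
  ⟨hf.measurable, by simpa using hQ.exists_bound_of_continuousOn hf.continuousOn⟩

lemma add (hf : BoundedMeasurableOn Q f) (hg : BoundedMeasurableOn Q g) :
    BoundedMeasurableOn Q fun x => f x + g x := by
  obtain ⟨hf, C, hC⟩ := hf
  obtain ⟨hg, C', hC'⟩ := hg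
  exact ⟨hf.add hg, C + C', fun x hx => (abs_add_le _ _).trans (add_le_add (hC x hx) (hC' x hx))⟩

lemma mul (hf : BoundedMeasurableOn Q f) (hg : BoundedMeasurableOn Q g) :
    BoundedMeasurableOn Q fun x => f x * g x := by
  obtain ⟨hf, C, hC⟩ := hf
  obtain ⟨hg, C', hC'⟩ := hg
  refine ⟨hf.mul hg, C * C', fun x hx => ?_⟩
  rw [abs_mul]
  exact mul_le_mul (hC x hx) (hC' x hx) (abs_nonneg _) ((abs_nonneg _).trans (hC x hx))

lemma const_mul (c : ℝ) (hf : BoundedMeasurableOn Q f) :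
    BoundedMeasurableOn Q fun x => c * f x :=
  (⟨measurable_const, |c|, fun _ _ => le_rfl⟩ : BoundedMeasurableOn Q fun _ => c).mul hf

lemma integrable_mul (hf : BoundedMeasurableOn Q f) {μ : Measure (Space d)}
    (hQ : MeasurableSet Q) (hg : Integrable g (μ.restrict Q)) :
    Integrable (fun x => g x * f x) (μ.restrict Q) := by
  obtain ⟨hf, C, hC⟩ := hf
  refine hg.mul_bdd (c := C) hf.aestronglyMeasurable ?_
  filter_upwards [ae_restrict_mem hQ] with x hx using hC x hx

lemma integrable (hf : BoundedMeasurableOn Q f) {μ : Measure (Space d)}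
    (hQ : MeasurableSet Q) (hμ : μ Q < ⊤) : Integrable f (μ.restrict Q) := by
  have : IsFiniteMeasure (μ.restrict Q) := ⟨by simpa using hμ⟩
  simpa using hf.integrable_mul (μ := μ) hQ (integrable_const (1 : ℝ))

end BoundedMeasurableOn

namespace Mesh

variable {s : Shape} {d : ℕ} (M : Mesh s d)

lemma integrable_cell {K : Fin M.numCells} {f : Space d → ℝ}
    (hf : BoundedMeasurableOn (M.cell K).carrier f) : Integrable f (M.cellMeasure K) :=
  hf.integrable (M.cell K).isCompact_carrier.measurableSet
    (M.cell K).isCompact_carrier.measure_lt_top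

lemma integrable_facet (hd : 0 < d) {K : Fin M.numCells} {j : s.Facet d} {f : Space d → ℝ}
    (hf : BoundedMeasurableOn ((M.cell K).facet j) f) : Integrable f (M.facetMeasure K j) :=
  hf.integrable ((M.cell K).isCompact_facet j).measurableSet ((M.cell K).measure_facet_lt_top hd j)

lemma integrable_cell_of_continuous {K : Fin M.numCells} {f : Space d → ℝ} (hf : Continuous f) :
    Integrable f (M.cellMeasure K) :=
  M.integrable_cell (.of_continuous (M.cell K).isCompact_carrier hf)

lemma integrable_facet_of_continuous (hd : 0 < d) {K : Fin M.numCells} {j : s.Facet d}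
    {f : Space d → ℝ} (hf : Continuous f) : Integrable f (M.facetMeasure K j) :=
  M.integrable_facet hd (.of_continuous ((M.cell K).isCompact_facet j) hf)

/-! ### The trace inequality for normal derivatives -/

variable {M}

lemma const_mem_dgSpace {p : Space d → ℝ} (hp : p ∈ localSpace s d) :
    (fun _ => p) ∈ M.dgSpace := fun _ _ => hp

lemma sq_le_of_sqrt_le {C a b h : ℝ} (hh : 0 < h) (ha : 0 ≤ a) (hb : 0 ≤ b)
    (hab : √a ≤ C * h ^ (-(1 / 2) : ℝ) * √b) : a ≤ C ^ 2 * h⁻¹ * b := by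
  have h1 := pow_le_pow_left₀ (Real.sqrt_nonneg a) hab 2
  rw [Real.sq_sqrt ha, mul_pow, mul_pow, Real.sq_sqrt hb, ← Real.rpow_natCast (h ^ _),
    ← Real.rpow_mul hh.le] at h1
  norm_num at h1
  rwa [Real.rpow_neg_one] at h1

lemma IsTraceConstant.facet_le {C : ℝ} (hC : M.IsTraceConstant C) (hd : 2 ≤ d)
    {p : Space d → ℝ} (hp : p ∈ localSpace s d) (K : Fin M.numCells) (j : s.Facet d) :
    ∫ x, p x ^ 2 ∂M.facetMeasure K j ≤
      C ^ 2 * (M.hCell K)⁻¹ * ∫ x, p x ^ 2 ∂M.cellMeasure K :=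
  sq_le_of_sqrt_le ((M.cell K).diam_carrier_pos hd) (integral_nonneg fun _ => sq_nonneg _)
    (integral_nonneg fun _ => sq_nonneg _) ((hC.2 _ (const_mem_dgSpace hp) K).1 j)

lemma IsTraceConstant.boundary_le {C : ℝ} (hC : M.IsTraceConstant C) (hd : 2 ≤ d)
    {p : Space d → ℝ} (hp : p ∈ localSpace s d) (K : Fin M.numCells)
    (hK : (M.cell K).IsGeneralHexahedron) :
    ∑ j, ∫ x, p x ^ 2 ∂M.facetMeasure K j ≤
      C ^ 2 * (M.hCell K)⁻¹ * ∫ x, p x ^ 2 ∂M.cellMeasure K :=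
  sq_le_of_sqrt_le ((M.cell K).diam_carrier_pos hd)
    (Finset.sum_nonneg fun _ _ => integral_nonneg fun _ => sq_nonneg _)
    (integral_nonneg fun _ => sq_nonneg _) ((hC.2 _ (const_mem_dgSpace hp) K).2 hK)

/-- The trace inequality on the single facets, summed over the facets of a cell. -/
lemma IsTraceConstant.sum_normal_le_of_sq_sum_le {C : ℝ} (hC : M.IsTraceConstant C) (hd : 2 ≤ d)
    {p : Space d → ℝ} (hp : p ∈ localSpace s d) (K : Fin M.numCells)
    (hK : ∀ G, ∑ j, M.hFacet K j * inner ℝ ((M.cell K).normal j) G ^ 2 ≤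
      2 * M.hCell K * ‖G‖ ^ 2) :
    ∑ j, M.hFacet K j *
        ∫ x, inner ℝ ((M.cell K).normal j) (gradient p x) ^ 2 ∂M.facetMeasure K j ≤
      2 * C ^ 2 * ∫ x, ‖gradient p x‖ ^ 2 ∂M.cellMeasure K := by
  have hpos : 0 < M.hCell K := (M.cell K).diam_carrier_pos hd
  have hgrad := continuous_gradient_of_mem_localSpace hp
  have hint : ∀ j, Integrable (fun x => M.hFacet K j *
      inner ℝ ((M.cell K).normal j) (gradient p x) ^ 2) (M.cellMeasure K) := fun j =>
    M.integrable_cell_of_continuous (by fun_prop)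
  calc _ ≤ ∑ j, M.hFacet K j * (C ^ 2 * (M.hCell K)⁻¹ *
        ∫ x, inner ℝ ((M.cell K).normal j) (gradient p x) ^ 2 ∂M.cellMeasure K) :=
        Finset.sum_le_sum fun j _ => mul_le_mul_of_nonneg_left
          (hC.facet_le hd (inner_gradient_mem_localSpace hp _) K j) Metric.diam_nonneg
    _ = C ^ 2 * (M.hCell K)⁻¹ * ∫ x, ∑ j, M.hFacet K j *
        inner ℝ ((M.cell K).normal j) (gradient p x) ^ 2 ∂M.cellMeasure K := by
        rw [integral_finsetSum _ fun j _ => hint j, Finset.mul_sum]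
        refine Finset.sum_congr rfl fun j _ => ?_
        rw [integral_const_mul]; ring
    _ ≤ C ^ 2 * (M.hCell K)⁻¹ * ∫ x, 2 * M.hCell K * ‖gradient p x‖ ^ 2 ∂M.cellMeasure K := by
        refine mul_le_mul_of_nonneg_left (integral_mono (integrable_finsetSum _ fun j _ => hint j)
          (M.integrable_cell_of_continuous (by fun_prop)) fun x => hK _) (by positivity)
    _ = _ := by rw [integral_const_mul]; field_simp

lemma sum_sq_inner_normal_le_of_isAxisParallel (K : Cell s d) (hK : K.IsAxisParallel)
    (G : Space d) : ∑ j, inner ℝ (K.normal j) G ^ 2 ≤ 2 * ‖G‖ ^ 2 := by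
  have h : ∀ j, ∃ i : Fin d × Bool, K.normal j =
      (if i.2 then (1 : ℝ) else -1) • EuclideanSpace.single i.1 (1 : ℝ) := by
    intro j
    obtain ⟨i, hi | hi⟩ := hK j
    · exact ⟨(i, true), by simp [hi]⟩
    · exact ⟨(i, false), by simp [hi]⟩
  choose σ hσ using h
  have hinj : Function.Injective σ := fun j k hjk =>
    K.normal_injective (by rw [hσ, hσ, hjk])
  calc ∑ j, inner ℝ (K.normal j) G ^ 2 = ∑ j, G (σ j).1 ^ 2 := by
        refine Finset.sum_congr rfl fun j _ => ?_
        rw [hσ, inner_smul_left, EuclideanSpace.inner_single_left]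
        split_ifs <;> simp
    _ = ∑ i ∈ Finset.univ.map ⟨σ, hinj⟩, G i.1 ^ 2 := by rw [Finset.sum_map]; rfl
    _ ≤ ∑ i : Fin d × Bool, G i.1 ^ 2 :=
        Finset.sum_le_sum_of_subset_of_nonneg (Finset.subset_univ _) fun _ _ _ => sq_nonneg _
    _ = 2 * ‖G‖ ^ 2 := by
        rw [Fintype.sum_prod_type, EuclideanSpace.norm_sq_eq, Finset.mul_sum]
        refine Finset.sum_congr rfl fun i _ => ?_
        simp [two_mul]

lemma sq_inner_normal_le (K : Cell s d) (j : s.Facet d) (G : Space d) :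
    inner ℝ (K.normal j) G ^ 2 ≤ ‖G‖ ^ 2 := by
  rw [← sq_abs]
  refine pow_le_pow_left₀ (abs_nonneg _) ?_ 2
  simpa [K.norm_normal] using abs_real_inner_le_norm (K.normal j) G

/-- Tetrahedra: the gradient is constant, and the trace inequality for `1 - 2 λ_j` gives
`|e| ≤ C² h_K⁻¹ |K| / 2`, which makes up for the number four of faces. -/
lemma IsTraceConstant.sum_normal_le_simplex {M : Mesh .simplex 3} {C : ℝ}
    (hC : M.IsTraceConstant C) {p : Space 3 → ℝ} (hp : p ∈ localSpace .simplex 3)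
    (K : Fin M.numCells) :
    ∑ j, M.hFacet K j *
        ∫ x, inner ℝ ((M.cell K).normal j) (gradient p x) ^ 2 ∂M.facetMeasure K j ≤
      2 * C ^ 2 * ∫ x, ‖gradient p x‖ ^ 2 ∂M.cellMeasure K := by
  have hpos : 0 < M.hCell K := (M.cell K).diam_carrier_pos (by norm_num)
  obtain ⟨G, hG⟩ := exists_gradient_eq_const hp
  set V := volume.real (M.cell K).carrier with hV
  have harea : ∀ j : Fin 4, (M.facetMeasure K j).real Set.univ ≤
      C ^ 2 * (M.hCell K)⁻¹ * (1 / 2 * V) := by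
    intro j
    have hmem : (fun x => 1 - 2 * (M.cell K).baryCoord j x) ∈ localSpace .simplex 3 := by
      set δ := (M.cell K).offset j - inner ℝ ((M.cell K).normal j) ((M.cell K).vertex j)
      convert affine_mem_localSpace (s := .simplex) (1 - 2 * ((M.cell K).offset j / δ))
        ((2 / δ) • (M.cell K).normal j) using 1
      funext x
      rw [Cell.baryCoord, inner_smul_left]
      simp only [conj_trivial]
      ring
    have h1 := hC.facet_le (by norm_num) hmem K j
    have h2 : ∫ x, (1 - 2 * (M.cell K).baryCoord j x) ^ 2 ∂M.facetMeasure K j =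
        (M.facetMeasure K j).real Set.univ := by
      rw [integral_congr_ae (g := fun _ => (1 : ℝ))]
      · simp
      · filter_upwards [ae_restrict_mem ((M.cell K).isCompact_facet j).measurableSet] with x hx
        rw [(M.cell K).baryCoord_of_mem_facet j hx]; norm_num
    rw [h2] at h1
    exact h1.trans (mul_le_mul_of_nonneg_left
      ((M.cell K).integral_sq_one_sub_two_baryCoord_le j) (by positivity))
  have hrhs : ∫ x, ‖gradient p x‖ ^ 2 ∂M.cellMeasure K = V * ‖G‖ ^ 2 := by
    simp [hG, cellMeasure, hV]
  rw [hrhs]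
  have hterm : ∀ j : Fin 4, M.hFacet K j *
      ∫ x, inner ℝ ((M.cell K).normal j) (gradient p x) ^ 2 ∂M.facetMeasure K j ≤
        1 / 2 * C ^ 2 * (V * ‖G‖ ^ 2) := by
    intro j
    simp only [hG, integral_const, smul_eq_mul]
    calc _ ≤ M.hCell K * (C ^ 2 * (M.hCell K)⁻¹ * (1 / 2 * V) * ‖G‖ ^ 2) := by
          refine mul_le_mul ((M.cell K).diam_facet_le j) (mul_le_mul (harea j)
            (sq_inner_normal_le _ _ _) (sq_nonneg _) ?_) ?_ hpos.le
          · exact measureReal_nonneg.trans (harea j)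
          · exact mul_nonneg measureReal_nonneg (sq_nonneg _)
      _ = _ := by field_simp
  calc _ ≤ ∑ _j : Fin 4, 1 / 2 * C ^ 2 * (V * ‖G‖ ^ 2) := Finset.sum_le_sum fun j _ => hterm j
    _ = _ := by simp; ring

/-- On a general hexahedron the trace constant refers to the whole boundary. -/
lemma IsTraceConstant.sum_normal_le_hexahedron {C : ℝ} (hC : M.IsTraceConstant C) (hd : 2 ≤ d)
    {p : Space d → ℝ} (hp : p ∈ localSpace s d) (K : Fin M.numCells)
    (hK : (M.cell K).IsGeneralHexahedron) :
    ∑ j, M.hFacet K j *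
        ∫ x, inner ℝ ((M.cell K).normal j) (gradient p x) ^ 2 ∂M.facetMeasure K j ≤
      2 * C ^ 2 * ∫ x, ‖gradient p x‖ ^ 2 ∂M.cellMeasure K := by
  have hpos : 0 < M.hCell K := (M.cell K).diam_carrier_pos hd
  have hgrad := continuous_gradient_of_mem_localSpace hp
  have hnorm : ∀ x, ‖gradient p x‖ ^ 2 =
      ∑ i, inner ℝ (EuclideanSpace.single i (1 : ℝ)) (gradient p x) ^ 2 := fun x => by
    generalize gradient p x = G
    simp [EuclideanSpace.norm_sq_eq, EuclideanSpace.inner_single_left]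
  have hnn : 0 ≤ ∫ x, ‖gradient p x‖ ^ 2 ∂M.cellMeasure K := integral_nonneg fun _ => sq_nonneg _
  calc _ ≤ ∑ j, M.hCell K * ∫ x, ‖gradient p x‖ ^ 2 ∂M.facetMeasure K j := by
        refine Finset.sum_le_sum fun j _ => mul_le_mul ((M.cell K).diam_facet_le j)
          (integral_mono ?_ ?_ fun x => sq_inner_normal_le _ _ _)
          (integral_nonneg fun _ => sq_nonneg _) hpos.le
        · exact M.integrable_facet_of_continuous (by omega) (by fun_prop)
        · exact M.integrable_facet_of_continuous (by omega) (by fun_prop)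
    _ = M.hCell K * ∑ i, ∑ j, ∫ x,
          inner ℝ (EuclideanSpace.single i (1 : ℝ)) (gradient p x) ^ 2 ∂M.facetMeasure K j := by
        rw [← Finset.mul_sum, Finset.sum_comm]
        congr 1
        refine Finset.sum_congr rfl fun j _ => ?_
        simp only [hnorm]
        exact integral_finsetSum _ fun i _ =>
          M.integrable_facet_of_continuous (by omega) (by fun_prop)
    _ ≤ M.hCell K * ∑ i, C ^ 2 * (M.hCell K)⁻¹ * ∫ x,
          inner ℝ (EuclideanSpace.single i (1 : ℝ)) (gradient p x) ^ 2 ∂M.cellMeasure K :=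
        mul_le_mul_of_nonneg_left (Finset.sum_le_sum fun i _ =>
          hC.boundary_le hd (inner_gradient_mem_localSpace hp _) K hK) hpos.le
    _ = C ^ 2 * ∫ x, ‖gradient p x‖ ^ 2 ∂M.cellMeasure K := by
        simp only [hnorm]
        rw [← Finset.mul_sum, integral_finsetSum _ fun i _ =>
          M.integrable_cell_of_continuous (by fun_prop)]
        field_simp
    _ ≤ _ := by nlinarith [mul_nonneg (sq_nonneg C) hnn]

/-- The normal derivatives on all facets of a cell are controlled by `2 C²` times the Dirichlet
integral, whatever the shape of the cell. The factor `2` is the one that the penalty condition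
allows. -/
lemma IsTraceConstant.sum_normal_le (hd : d = 2 ∨ d = 3) {C : ℝ} (hC : M.IsTraceConstant C)
    {p : Space d → ℝ} (hp : p ∈ localSpace s d) (K : Fin M.numCells) :
    ∑ j, M.hFacet K j *
        ∫ x, inner ℝ ((M.cell K).normal j) (gradient p x) ^ 2 ∂M.facetMeasure K j ≤
      2 * C ^ 2 * ∫ x, ‖gradient p x‖ ^ 2 ∂M.cellMeasure K := by
  rcases hd with rfl | rfl
  · exact hC.sum_normal_le_of_sq_sum_le le_rfl hp K (M.cell K).sum_diam_mul_sq_inner_normal_le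
  · cases s with
    | simplex => exact hC.sum_normal_le_simplex hp K
    | cuboid =>
      by_cases hK : (M.cell K).IsAxisParallel
      · refine hC.sum_normal_le_of_sq_sum_le (by norm_num) hp K fun G => ?_
        calc _ ≤ ∑ j, M.hCell K * inner ℝ ((M.cell K).normal j) G ^ 2 :=
              Finset.sum_le_sum fun j _ => mul_le_mul_of_nonneg_right
                ((M.cell K).diam_facet_le j) (sq_nonneg _)
          _ ≤ M.hCell K * (2 * ‖G‖ ^ 2) := by
              rw [← Finset.mul_sum]
              exact mul_le_mul_of_nonneg_left
                (sum_sq_inner_normal_le_of_isAxisParallel _ hK G) Metric.diam_nonneg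
          _ = _ := by ring
      · exact hC.sum_normal_le_hexahedron (by norm_num) hp K ⟨rfl, rfl, hK⟩

/-! ### Sums over the skeleton -/

section Skeleton

variable {s : Shape} {d : ℕ} {M : Mesh s d}

/-- An oriented interior facet is determined by its first element and the label there, since at most
two elements share a facet. -/
lemma InteriorFacet.eq_of_left {e e' : M.InteriorFacet} (h : e.left = e'.left)
    (hl : e.leftLabel = e'.leftLabel) : e = e' := by
  obtain ⟨K, L, j, k, hne, hs⟩ := e
  obtain ⟨K', L', j', k', hne', hs'⟩ := e'
  simp only at h hl
  subst h hl
  obtain rfl : L = L' := M.facet_shared K L L' j k k' hne hne' hs hs'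
  obtain rfl : k = k' := (M.cell L).facet_injective (hs.symm.trans hs')
  rfl

lemma Skeleton.swap_notMem (S : M.Skeleton) {e : M.InteriorFacet} (he : e ∈ S.facets) :
    e.swap ∉ S.facets := by
  rcases S.once e with h | h
  · exact h.2
  · exact absurd he h.2

/-- Every pair of an element and one of its facets occurs at most once in the skeleton. -/
lemma Skeleton.sum_sides_le (S : M.Skeleton) {T : Fin M.numCells → s.Facet d → ℝ}
    (hT : ∀ K j, 0 ≤ T K j) :
    ∑ e ∈ S.facets, (T e.left e.leftLabel + T e.right e.rightLabel) ≤ ∑ K, ∑ j, T K j := by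
  classical
  let φ : M.InteriorFacet × Bool → Fin M.numCells × s.Facet d := fun p =>
    if p.2 then (p.1.left, p.1.leftLabel) else (p.1.right, p.1.rightLabel)
  have hinj : Set.InjOn φ (S.facets ×ˢ (Finset.univ : Finset Bool) : Finset _) := by
    rintro ⟨e, b⟩ he ⟨e', b'⟩ he' h
    simp only [Finset.coe_product, Finset.coe_univ, Set.mem_prod, Finset.mem_coe, Set.mem_univ,
      and_true] at he he'
    cases b <;> cases b' <;> simp only [φ, if_true, Bool.false_eq_true, if_false,
      Prod.mk.injEq] at h
    · have : e.swap = e'.swap := InteriorFacet.eq_of_left h.1 h.2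
      have h2 : e.swap.swap = e'.swap.swap := by rw [this]
      exact congrArg (·, false) (h2 : e = e')
    · have : e.swap = e' := InteriorFacet.eq_of_left h.1 h.2
      exact absurd (this ▸ he') (S.swap_notMem he)
    · have : e = e'.swap := InteriorFacet.eq_of_left h.1 h.2
      exact absurd (this ▸ he) (S.swap_notMem he')
    · exact congrArg (·, true) (InteriorFacet.eq_of_left h.1 h.2)
  calc _ = ∑ p ∈ S.facets ×ˢ (Finset.univ : Finset Bool), T (φ p).1 (φ p).2 := by
        rw [Finset.sum_product]
        refine Finset.sum_congr rfl fun e _ => ?_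
        simp [φ]
    _ = ∑ p ∈ (S.facets ×ˢ (Finset.univ : Finset Bool)).image φ, T p.1 p.2 := by
        rw [Finset.sum_image hinj]
    _ ≤ ∑ p : Fin M.numCells × s.Facet d, T p.1 p.2 :=
        Finset.sum_le_sum_of_subset_of_nonneg (Finset.subset_univ _) fun _ _ _ => hT _ _
    _ = _ := Fintype.sum_prod_type _

lemma InteriorFacet.measure_eq_right (e : M.InteriorFacet) :
    e.measure = M.facetMeasure e.right e.rightLabel := by
  unfold InteriorFacet.measure facetMeasure
  rw [e.same]

lemma InteriorFacet.size_eq_right (e : M.InteriorFacet) :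
    e.size = M.hFacet e.right e.rightLabel := by
  unfold InteriorFacet.size hFacet
  rw [e.same]

lemma InteriorFacet.sq_inner_normal_eq_right (hd : 0 < d) (e : M.InteriorFacet) (G : Space d) :
    inner ℝ e.normal G ^ 2 = inner ℝ ((M.cell e.right).normal e.rightLabel) G ^ 2 := by
  have h := (M.cell e.right).eq_or_eq_neg_normal hd e.rightLabel
    ((M.cell e.left).norm_normal e.leftLabel) (c := (M.cell e.left).offset e.leftLabel)
    (fun x hx => (M.cell e.left).inner_normal_of_mem_facet (e.same ▸ hx))
  unfold InteriorFacet.normal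
  rcases h with h | h
  · rw [h]
  · rw [h, inner_neg_left, neg_sq]

lemma integrable_interiorFacet (hd : 0 < d) {e : M.InteriorFacet} {f : Space d → ℝ}
    (hf : BoundedMeasurableOn ((M.cell e.left).facet e.leftLabel) f) : Integrable f e.measure :=
  M.integrable_facet hd hf

/-- The normal derivatives on both sides of the skeleton are controlled by the broken Dirichlet
integral. -/
lemma IsTraceConstant.sum_skeleton_le (hd : d = 2 ∨ d = 3) {C : ℝ} (hC : M.IsTraceConstant C)
    (S : M.Skeleton) {z : M.Broken ℝ} (hz : z ∈ M.dgSpace) :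
    ∑ e ∈ S.facets, e.size * ∫ x, (inner ℝ (brokenGrad z e.left x) e.normal ^ 2 +
        inner ℝ (brokenGrad z e.right x) e.normal ^ 2) ∂e.measure ≤
      2 * C ^ 2 * ∑ K, ∫ x, ‖brokenGrad z K x‖ ^ 2 ∂M.cellMeasure K := by
  have hz' : ∀ K, z K ∈ localSpace s d := fun K => hz K trivial
  have hg : ∀ K, Continuous (gradient (z K)) := fun K =>
    continuous_gradient_of_mem_localSpace (hz' K)
  have hd0 : 0 < d := by omega
  let T : Fin M.numCells → s.Facet d → ℝ := fun K j => M.hFacet K j *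
    ∫ x, inner ℝ ((M.cell K).normal j) (gradient (z K) x) ^ 2 ∂M.facetMeasure K j
  have hT : ∀ K j, 0 ≤ T K j := fun K j =>
    mul_nonneg Metric.diam_nonneg (integral_nonneg fun _ => sq_nonneg _)
  calc _ = ∑ e ∈ S.facets, (T e.left e.leftLabel + T e.right e.rightLabel) := by
        refine Finset.sum_congr rfl fun e _ => ?_
        rw [integral_add, mul_add]
        · congr 1
          · simp only [T, brokenGrad, real_inner_comm e.normal]
            rfl
          · simp only [T, brokenGrad]
            rw [e.size_eq_right, e.measure_eq_right]
            simp only [← e.sq_inner_normal_eq_right hd0, real_inner_comm e.normal]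
        · exact M.integrable_facet_of_continuous hd0 (by unfold brokenGrad; fun_prop)
        · exact M.integrable_facet_of_continuous hd0 (by unfold brokenGrad; fun_prop)
    _ ≤ ∑ K, ∑ j, T K j := S.sum_sides_le hT
    _ ≤ ∑ K, 2 * C ^ 2 * ∫ x, ‖gradient (z K) x‖ ^ 2 ∂M.cellMeasure K :=
        Finset.sum_le_sum fun K _ => hC.sum_normal_le hd (hz' K) K
    _ = _ := by rw [← Finset.mul_sum]; rfl

end Skeleton

/-! ### Weighted and harmonic averages -/

section Averages

variable {s : Shape} {d : ℕ} {M : Mesh s d}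

/-- A measurable coefficient with values in `[lo, hi]`, where `lo > 0`. -/
structure IsPositiveCoeff (A : M.Broken ℝ) (lo hi : ℝ) : Prop where
  measurable : ∀ K, Measurable (A K)
  pos : 0 < lo
  lower : ∀ K x, lo ≤ A K x
  upper : ∀ K x, A K x ≤ hi

namespace IsPositiveCoeff

variable {A : M.Broken ℝ} {lo hi : ℝ} (hA : IsPositiveCoeff A lo hi)

include hA

lemma value_pos (K : Fin M.numCells) (x : Space d) : 0 < A K x := hA.pos.trans_le (hA.lower K x)

lemma boundedMeasurableOn (K : Fin M.numCells) (Q : Set (Space d)) :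
    BoundedMeasurableOn Q (A K) :=
  ⟨hA.measurable K, hi, fun x _ => by rw [abs_of_pos (hA.value_pos K x)]; exact hA.upper K x⟩

lemma harmonicAvg_nonneg (e : M.InteriorFacet) (x : Space d) : 0 ≤ harmonicAvg A e x := by
  have h1 := hA.value_pos e.left x
  have h2 := hA.value_pos e.right x
  unfold harmonicAvg
  positivity

lemma harmonicAvg_le (e : M.InteriorFacet) (x : Space d) : harmonicAvg A e x ≤ hi := by
  have h1 := hA.value_pos e.left x
  have h2 := hA.value_pos e.right x
  have h3 := hA.upper e.left x
  have h4 := hA.upper e.right x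
  unfold harmonicAvg
  rw [div_le_iff₀ (by positivity)]
  nlinarith [mul_nonneg h1.le (sub_nonneg.2 h4), mul_nonneg h2.le (sub_nonneg.2 h3)]

lemma boundedMeasurableOn_harmonicAvg (e : M.InteriorFacet) (Q : Set (Space d)) :
    BoundedMeasurableOn Q (harmonicAvg A e) := by
  refine ⟨?_, hi, fun x _ => ?_⟩
  · have h1 := hA.measurable e.left
    have h2 := hA.measurable e.right
    unfold harmonicAvg
    fun_prop
  · rw [abs_of_nonneg (hA.harmonicAvg_nonneg e x)]
    exact hA.harmonicAvg_le e x

/-- The weights are such that both fluxes are multiplied by half the harmonic average. -/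
lemma weightedAvg_eq (G : M.Broken (Space d)) (e : M.InteriorFacet) (x : Space d) :
    weightedAvg A G e x = harmonicAvg A e x *
      (1 / 2 * (inner ℝ (G e.left x) e.normal + inner ℝ (G e.right x) e.normal)) := by
  have h1 := hA.value_pos e.left x
  have h2 := hA.value_pos e.right x
  unfold weightedAvg harmonicAvg
  field_simp

lemma boundedMeasurableOn_weightedAvg {G : M.Broken (Space d)} (hG : ∀ K, Continuous (G K))
    (e : M.InteriorFacet) {Q : Set (Space d)} (hQ : IsCompact Q) :
    BoundedMeasurableOn Q (weightedAvg A G e) := by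
  have h : weightedAvg A G e = fun x => harmonicAvg A e x *
      (1 / 2 * (inner ℝ (G e.left x) e.normal + inner ℝ (G e.right x) e.normal)) :=
    funext fun x => hA.weightedAvg_eq G e x
  rw [h]
  have h1 := hG e.left
  have h2 := hG e.right
  exact (hA.boundedMeasurableOn_harmonicAvg e Q).mul (.of_continuous hQ (by fun_prop))

end IsPositiveCoeff

/-- For `ρ = 0` both sides vanish, because `0 / 0 = 0`. -/
lemma weightedAvg_const_mul (ρ : ℝ) (A : M.Broken ℝ) (G : M.Broken (Space d))
    (e : M.InteriorFacet) (x : Space d) :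
    weightedAvg (fun K x => ρ * A K x) G e x = ρ * weightedAvg A G e x := by
  unfold weightedAvg
  rcases eq_or_ne ρ 0 with rfl | hρ
  · simp
  · rw [← mul_add, mul_div_mul_left _ _ hρ, mul_div_mul_left _ _ hρ]
    ring

end Averages

end Mesh

/-! ### Linearity of the forms -/

section IsLinearMap

variable {E : Type*} [AddCommGroup E] [Module ℝ E] {f g : E → ℝ}

lemma isLinearMap_add (hf : IsLinearMap ℝ f) (hg : IsLinearMap ℝ g) :
    IsLinearMap ℝ fun v => f v + g v := (hf.mk' f + hg.mk' g).isLinear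

lemma isLinearMap_sub (hf : IsLinearMap ℝ f) (hg : IsLinearMap ℝ g) :
    IsLinearMap ℝ fun v => f v - g v := (hf.mk' f - hg.mk' g).isLinear

lemma isLinearMap_const_mul (c : ℝ) (hf : IsLinearMap ℝ f) :
    IsLinearMap ℝ fun v => c * f v := (c • hf.mk' f).isLinear

lemma isLinearMap_mul_const (c : ℝ) (hf : IsLinearMap ℝ f) :
    IsLinearMap ℝ fun v => f v * c := by
  simpa only [mul_comm] using isLinearMap_const_mul c hf

lemma isLinearMap_sum {ι : Type*} (t : Finset ι) {f : ι → E → ℝ}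
    (hf : ∀ i, IsLinearMap ℝ (f i)) : IsLinearMap ℝ fun v => ∑ i ∈ t, f i v := by
  convert (∑ i ∈ t, (hf i).mk' (f i)).isLinear using 1
  funext v
  simp

lemma isLinearMap_integral {α : Type*} [MeasurableSpace α] {μ : Measure α} {f : E → α → ℝ}
    (hf : ∀ x, IsLinearMap ℝ fun v => f v x) (hint : ∀ v, Integrable (f v) μ) :
    IsLinearMap ℝ fun v => ∫ x, f v x ∂μ where
  map_add v w := by
    rw [← integral_add (hint v) (hint w)]
    exact integral_congr_ae (ae_of_all _ fun x => (hf x).map_add v w)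
  map_smul c v := by
    rw [smul_eq_mul, ← integral_const_mul]
    exact integral_congr_ae (ae_of_all _ fun x => (hf x).map_smul c v)

/-- A linear problem whose trial functions run through the translate `g + V` of the
finite-dimensional test space `V` has exactly one solution, provided that `z = 0` is the only
`z ∈ V` with `a z z = 0`. -/
lemma existsUnique_of_definite {X V : Submodule ℝ E} (hVX : V ≤ X) [FiniteDimensional ℝ V]
    {a : E → E → ℝ} {l : E → ℝ} (ha : ∀ w ∈ V, IsLinearMap ℝ fun v : X => a v w)
    (ha' : ∀ v ∈ X, IsLinearMap ℝ fun w : X => a v w) (hl : IsLinearMap ℝ fun w : X => l w)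
    (hpos : ∀ z ∈ V, a z z = 0 → z = 0) {g : E} (hg : g ∈ X) :
    ∃! S, S ∈ X ∧ S - g ∈ V ∧ ∀ w ∈ V, a S w = l w := by
  let ι : V →ₗ[ℝ] X := Submodule.inclusion hVX
  let B : V →ₗ[ℝ] V →ₗ[ℝ] ℝ := LinearMap.mk₂ ℝ (fun v w => a v w)
    (fun v v' w => (ha w w.2).map_add (ι v) (ι v')) (fun c v w => (ha w w.2).map_smul c (ι v))
    (fun v w w' => (ha' v (hVX v.2)).map_add (ι w) (ι w'))
    (fun c v w => (ha' v (hVX v.2)).map_smul c (ι w))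
  let F : V →ₗ[ℝ] ℝ := ((hl.mk' _) - ((ha' g hg).mk' _)).comp ι
  have hinj : Function.Injective B := by
    rw [← LinearMap.ker_eq_bot, LinearMap.ker_eq_bot']
    intro z hz
    exact Subtype.ext (hpos z z.2 (congrArg (fun φ => φ z) hz))
  have hsurj : Function.Surjective B :=
    (LinearMap.injective_iff_surjective_of_finrank_eq_finrank
      (Subspace.dual_finrank_eq (K := ℝ) (V := V)).symm).1 hinj
  obtain ⟨z, hz⟩ := hsurj F
  refine ⟨g + z, ⟨X.add_mem hg (hVX z.2), by simp, fun w hw => ?_⟩, ?_⟩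
  · have h1 : a z w = l w - a g w := congrArg (fun φ => φ ⟨w, hw⟩) hz
    have h2 : a (g + z) w = a g w + a z w := (ha w hw).map_add ⟨g, hg⟩ ⟨z, hVX z.2⟩
    rw [h2, h1]; ring
  · rintro S ⟨hS, hSg, hSw⟩
    have hB : B ⟨S - g, hSg⟩ = F := by
      ext ⟨w, hw⟩
      have h2 : a (S - g) w = a S w - a g w := (ha w hw).map_sub ⟨S, hS⟩ ⟨g, hg⟩
      change a (S - g) w = l w - a g w
      rw [h2, hSw w hw]
    have := congrArg Subtype.val (hinj (hB.trans hz.symm))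
    rw [← this]
    simp

end IsLinearMap

namespace Mesh

variable {s : Shape} {d : ℕ} {M : Mesh s d}

lemma mem_localSpace (v : M.dgSpace) (K : Fin M.numCells) : v.1 K ∈ localSpace s d :=
  v.2 K trivial

lemma continuous_dg (v : M.dgSpace) (K : Fin M.numCells) : Continuous (v.1 K) :=
  continuous_of_mem_localSpace (mem_localSpace v K)

lemma continuous_brokenGrad (v : M.dgSpace) (K : Fin M.numCells) :
    Continuous (brokenGrad v.1 K) :=
  continuous_gradient_of_mem_localSpace (mem_localSpace v K)

lemma continuous_jump (v : M.dgSpace) (e : M.InteriorFacet) : Continuous (jump v.1 e) :=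
  (continuous_dg v _).sub (continuous_dg v _)

instance instFiniteDimensionalDgSpace : FiniteDimensional ℝ M.dgSpace := by
  let Φ : M.dgSpace →ₗ[ℝ] (Fin M.numCells → localSpace s d) := LinearMap.pi fun K =>
    ((LinearMap.proj K).comp M.dgSpace.subtype).codRestrict _ fun v => mem_localSpace v K
  refine FiniteDimensional.of_injective Φ fun v w h => Subtype.ext (funext fun K => ?_)
  exact congrArg Subtype.val (congrFun h K)

lemma isLinearMap_value (K : Fin M.numCells) (x : Space d) :
    IsLinearMap ℝ fun v : M.dgSpace => v.1 K x := ⟨fun _ _ => rfl, fun _ _ => rfl⟩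

lemma isLinearMap_jump (e : M.InteriorFacet) (x : Space d) :
    IsLinearMap ℝ fun v : M.dgSpace => jump v.1 e x :=
  isLinearMap_sub (isLinearMap_value _ _) (isLinearMap_value _ _)

lemma isLinearMap_inner_brokenGrad (K : Fin M.numCells) (n x : Space d) :
    IsLinearMap ℝ fun v : M.dgSpace => inner ℝ n (brokenGrad v.1 K x) where
  map_add v w := by
    have := gradient_add_of_differentiable (differentiable_of_mem_localSpace (mem_localSpace v K))
      (differentiable_of_mem_localSpace (mem_localSpace w K))
    change inner ℝ n (gradient (v.1 K + w.1 K) x) = _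
    rw [this, Pi.add_apply, inner_add_right]
    rfl
  map_smul c v := by
    have := gradient_const_smul_of_differentiable
      (differentiable_of_mem_localSpace (mem_localSpace v K)) c
    change inner ℝ n (gradient (c • v.1 K) x) = _
    rw [this, Pi.smul_apply, inner_smul_right]
    rfl

lemma isLinearMap_weightedAvg (A : M.Broken ℝ) (e : M.InteriorFacet) (x : Space d) :
    IsLinearMap ℝ fun v : M.dgSpace => weightedAvg A (brokenGrad v.1) e x := by
  unfold weightedAvg
  simp only [real_inner_comm e.normal]
  exact isLinearMap_add
    (isLinearMap_const_mul _ (isLinearMap_const_mul _ (isLinearMap_inner_brokenGrad _ _ _)))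
    (isLinearMap_const_mul _ (isLinearMap_const_mul _ (isLinearMap_inner_brokenGrad _ _ _)))

/-- A discrete function that vanishes almost everywhere on every cell is zero. -/
lemma eq_zero_of_integral_sq_eq_zero (hd : 0 < d) {z : M.Broken ℝ} (hz : z ∈ M.dgSpace)
    (h : ∀ K, ∫ x, z K x ^ 2 ∂M.cellMeasure K = 0) : z = 0 := by
  funext K
  have hloc : z K ∈ localSpace s d := hz K trivial
  have hcont := continuous_of_mem_localSpace hloc
  refine eq_zero_of_mem_localSpace hloc isOpen_interior
    ((M.cell K).interior_carrier_nonempty hd) ?_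
  have h1 := (integral_eq_zero_iff_of_nonneg (fun _ => sq_nonneg _)
    (M.integrable_cell_of_continuous (hcont.pow 2))).1 (h K)
  have h2 : z K =ᵐ[volume.restrict (interior (M.cell K).carrier)] fun _ => 0 := by
    have := ae_restrict_of_ae_restrict_of_subset interior_subset h1
    filter_upwards [this] with x hx using by simpa using hx
  exact fun x hx => Measure.eqOn_open_of_ae_eq h2 isOpen_interior hcont.continuousOn
    continuousOn_const hx

lemma restrict_carrier_le_restrict_domain (K : Fin M.numCells) :
    M.cellMeasure K ≤ volume.restrict M.domain := by
  have h : (M.cell K).carrier =ᵐ[volume] interior (M.cell K).carrier :=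
    (interior_ae_eq_of_null_frontier
      (Convex.addHaar_frontier volume (convex_convexHull ℝ _))).symm
  unfold cellMeasure
  rw [Measure.restrict_congr_set h]
  exact Measure.restrict_mono
    (interior_mono (Set.subset_iUnion (fun K => (M.cell K).carrier) K)) le_rfl

end Mesh

namespace FlowData

open Mesh

variable {s : Shape} {d : ℕ} {M : Mesh s d} (D : FlowData M)

section Bilinear

variable {Sa Sv : M.Broken ℝ} {lo hi : ℝ} (hA : IsPositiveCoeff (D.coeffA Sa Sv) lo hi)

include hA

lemma integrable_volume_term (v w : M.dgSpace) (K : Fin M.numCells) :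
    Integrable (fun x => D.coeffA Sa Sv K x *
      inner ℝ (brokenGrad v.1 K x) (brokenGrad w.1 K x)) (M.cellMeasure K) := by
  have h1 := continuous_brokenGrad v K
  have h2 := continuous_brokenGrad w K
  exact M.integrable_cell ((hA.boundedMeasurableOn K _).mul
    (.of_continuous (M.cell K).isCompact_carrier (by fun_prop)))

lemma integrable_flux_term (hd : 0 < d) (v w : M.dgSpace) (e : M.InteriorFacet) :
    Integrable (fun x => weightedAvg (D.coeffA Sa Sv) (brokenGrad v.1) e x * jump w.1 e x)
      e.measure :=
  integrable_interiorFacet hd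
    ((hA.boundedMeasurableOn_weightedAvg (continuous_brokenGrad v) e
      ((M.cell e.left).isCompact_facet _)).mul
        (.of_continuous ((M.cell e.left).isCompact_facet _) (continuous_jump w e)))

lemma integrable_penalty_term (hd : 0 < d) (v w : M.dgSpace) (e : M.InteriorFacet) :
    Integrable (fun x => harmonicAvg (D.coeffA Sa Sv) e x * jump v.1 e x * jump w.1 e x)
      e.measure :=
  integrable_interiorFacet hd
    (((hA.boundedMeasurableOn_harmonicAvg e _).mul
      (.of_continuous ((M.cell e.left).isCompact_facet _) (continuous_jump v e))).mul
        (.of_continuous ((M.cell e.left).isCompact_facet _) (continuous_jump w e)))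

lemma isLinearMap_bA_left (hd : 0 < d) (w : M.dgSpace) :
    IsLinearMap ℝ fun v : M.dgSpace => D.bA Sa Sv v w := by
  unfold bA
  refine isLinearMap_add (isLinearMap_add (isLinearMap_sub ?_ ?_) ?_) (isLinearMap_const_mul _ ?_)
  · refine isLinearMap_sum _ fun K => isLinearMap_integral (fun x => isLinearMap_const_mul _ ?_)
      fun v => D.integrable_volume_term hA v w K
    simp only [real_inner_comm (brokenGrad w.1 K x)]
    exact isLinearMap_inner_brokenGrad _ _ _
  · exact isLinearMap_sum _ fun e => isLinearMap_integral
      (fun x => isLinearMap_mul_const _ (isLinearMap_weightedAvg _ _ _))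
      fun v => D.integrable_flux_term hA hd v w e
  · exact isLinearMap_sum _ fun e => isLinearMap_const_mul _ (isLinearMap_integral
      (fun x => isLinearMap_mul_const _ (isLinearMap_const_mul _ (isLinearMap_jump _ _)))
      fun v => D.integrable_penalty_term hA hd v w e)
  · exact isLinearMap_sum _ fun e => isLinearMap_integral
      (fun x => isLinearMap_const_mul _ (isLinearMap_jump _ _))
      fun v => D.integrable_flux_term hA hd w v e

lemma isLinearMap_bA_right (hd : 0 < d) (v : M.dgSpace) :
    IsLinearMap ℝ fun w : M.dgSpace => D.bA Sa Sv v w := by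
  unfold bA
  refine isLinearMap_add (isLinearMap_add (isLinearMap_sub ?_ ?_) ?_) (isLinearMap_const_mul _ ?_)
  · exact isLinearMap_sum _ fun K => isLinearMap_integral
      (fun x => isLinearMap_const_mul _ (isLinearMap_inner_brokenGrad _ _ _))
      fun w => D.integrable_volume_term hA v w K
  · exact isLinearMap_sum _ fun e => isLinearMap_integral
      (fun x => isLinearMap_const_mul _ (isLinearMap_jump _ _))
      fun w => D.integrable_flux_term hA hd v w e
  · exact isLinearMap_sum _ fun e => isLinearMap_const_mul _ (isLinearMap_integral
      (fun x => isLinearMap_const_mul _ (isLinearMap_jump _ _))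
      fun w => D.integrable_penalty_term hA hd v w e)
  · exact isLinearMap_sum _ fun e => isLinearMap_integral
      (fun x => isLinearMap_mul_const _ (isLinearMap_weightedAvg _ _ _))
      fun w => D.integrable_flux_term hA hd w v e

/-- The form `b_a` is nonnegative under the penalty condition. By Young's inequality each facet
contributes at least `-(1-θ)² hi h_e / (8 α)` times the squared normal derivatives on its two sides,
and these add up to at most `2 C²` times the Dirichlet integral. -/
lemma bA_self_nonneg (hd : d = 2 ∨ d = 3) {α C : ℝ} (hα : 0 < α)
    (hαe : ∀ e ∈ D.skeleton.facets, α ≤ D.alphaA e) (hC : M.IsTraceConstant C)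
    (hpen : (1 - D.theta) ^ 2 * hi * C ^ 2 ≤ 4 * α * lo) {z : M.Broken ℝ} (hz : z ∈ M.dgSpace) :
    0 ≤ D.bA Sa Sv z z := by
  have hd0 : 0 < d := by omega
  set c := (1 - D.theta) ^ 2 * hi / (8 * α) with hc
  set A := D.coeffA Sa Sv with hAdef
  set W := ∑ K, ∫ x, ‖brokenGrad z K x‖ ^ 2 ∂M.cellMeasure K with hW
  have hW0 : 0 ≤ W := Finset.sum_nonneg fun K _ => integral_nonneg fun _ => sq_nonneg _
  have hgz : ∀ K, Continuous (brokenGrad z K) := fun K => continuous_brokenGrad ⟨z, hz⟩ K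
  have hvol : lo * W ≤
      ∑ K, ∫ x, A K x * inner ℝ (brokenGrad z K x) (brokenGrad z K x) ∂M.cellMeasure K := by
    rw [hW, Finset.mul_sum]
    refine Finset.sum_le_sum fun K _ => ?_
    rw [← integral_const_mul]
    refine integral_mono (M.integrable_cell_of_continuous (by have := hgz K; fun_prop))
      (D.integrable_volume_term hA ⟨z, hz⟩ ⟨z, hz⟩ K) fun x => ?_
    rw [real_inner_self_eq_norm_sq]
    exact mul_le_mul_of_nonneg_right (hA.lower K x) (sq_nonneg _)
  have hfacet : ∀ e ∈ D.skeleton.facets,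
      -(c * (e.size * ∫ x, (inner ℝ (brokenGrad z e.left x) e.normal ^ 2 +
        inner ℝ (brokenGrad z e.right x) e.normal ^ 2) ∂e.measure)) ≤
      -(∫ x, weightedAvg A (brokenGrad z) e x * jump z e x ∂e.measure)
      + D.alphaA e * e.size⁻¹ * (∫ x, harmonicAvg A e x * jump z e x * jump z e x ∂e.measure)
      + D.theta * ∫ x, weightedAvg A (brokenGrad z) e x * jump z e x ∂e.measure := by
    intro e he
    have hsize : 0 < e.size := (M.cell e.left).diam_facet_pos (by omega) _
    have i1 : Integrable (fun x => weightedAvg A (brokenGrad z) e x * jump z e x) e.measure :=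
      D.integrable_flux_term hA hd0 ⟨z, hz⟩ ⟨z, hz⟩ e
    have i1' : Integrable (fun x => -(weightedAvg A (brokenGrad z) e x * jump z e x)) e.measure :=
      i1.neg
    have i2 : Integrable (fun x => harmonicAvg A e x * jump z e x * jump z e x) e.measure :=
      D.integrable_penalty_term hA hd0 ⟨z, hz⟩ ⟨z, hz⟩ e
    have i12 : Integrable (fun x => -(weightedAvg A (brokenGrad z) e x * jump z e x) +
        D.alphaA e * e.size⁻¹ * (harmonicAvg A e x * jump z e x * jump z e x)) e.measure :=
      i1'.add (i2.const_mul _)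
    have i3 : Integrable (fun x => inner ℝ (brokenGrad z e.left x) e.normal ^ 2 +
        inner ℝ (brokenGrad z e.right x) e.normal ^ 2) e.measure :=
      M.integrable_facet_of_continuous hd0
        (by have := hgz e.left; have := hgz e.right; fun_prop)
    rw [← mul_assoc, ← integral_const_mul, ← integral_neg, ← integral_neg, ← integral_const_mul,
      ← integral_const_mul, ← integral_add i1' (i2.const_mul _), ← integral_add
        i12 (i1.const_mul _)]
    refine integral_mono (i3.const_mul _).neg
      (i12.add (i1.const_mul _)) fun x => ?_
    rw [hA.weightedAvg_eq]
    have hH := hA.harmonicAvg_nonneg e x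
    have hH' := hA.harmonicAvg_le e x
    generalize harmonicAvg A e x = H at hH hH'
    generalize inner ℝ (brokenGrad z e.left x) e.normal = p
    generalize inner ℝ (brokenGrad z e.right x) e.normal = q
    generalize jump z e x = J
    have hαe' := hαe e he
    generalize D.alphaA e = β at hαe'
    generalize e.size = h at hsize
    generalize D.theta = θ at hc
    -- complete the square in the jump
    have k1 : 0 ≤ H * (α * h⁻¹ * (J - (1 - θ) * h * (p + q) / (4 * α)) ^ 2) := by positivity
    have k2 : 0 ≤ H * ((β - α) * h⁻¹ * J ^ 2) :=
      mul_nonneg hH (mul_nonneg (mul_nonneg (sub_nonneg.2 hαe') (by positivity)) (sq_nonneg _))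
    have k3 : 0 ≤ (1 - θ) ^ 2 * h / (8 * α) * ((hi - H) * (p ^ 2 + q ^ 2)) :=
      mul_nonneg (by positivity) (mul_nonneg (sub_nonneg.2 hH') (by positivity))
    have k4 : 0 ≤ (1 - θ) ^ 2 * h / (16 * α) * H * (p - q) ^ 2 := by positivity
    have key : -(H * (1 / 2 * (p + q)) * J) + β * h⁻¹ * (H * J * J) +
        θ * (H * (1 / 2 * (p + q)) * J) + c * h * (p ^ 2 + q ^ 2) =
        H * (α * h⁻¹ * (J - (1 - θ) * h * (p + q) / (4 * α)) ^ 2) +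
        H * ((β - α) * h⁻¹ * J ^ 2) +
        (1 - θ) ^ 2 * h / (8 * α) * ((hi - H) * (p ^ 2 + q ^ 2)) +
        (1 - θ) ^ 2 * h / (16 * α) * H * (p - q) ^ 2 := by
      rw [hc]
      field_simp
      ring
    linarith
  have hsum := Finset.sum_le_sum hfacet
  rw [Finset.sum_neg_distrib, ← Finset.mul_sum, Finset.sum_add_distrib, Finset.sum_add_distrib,
    Finset.sum_neg_distrib, ← Finset.mul_sum] at hsum
  have hsk := hC.sum_skeleton_le hd D.skeleton hz
  have hi0 : 0 ≤ hi := by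
    have := hA.upper ⟨0, M.numCells_pos⟩ 0
    exact (hA.value_pos _ _).le.trans this
  have hc0 : 0 ≤ c := by positivity
  have h1 := mul_le_mul_of_nonneg_left hsk hc0
  have h2 : c * (2 * C ^ 2 * W) ≤ lo * W := by
    rw [← mul_assoc]
    refine mul_le_mul_of_nonneg_right ?_ hW0
    have : c * (2 * C ^ 2) = (1 - D.theta) ^ 2 * hi * C ^ 2 / (4 * α) := by
      rw [hc]; field_simp; ring
    rw [this, div_le_iff₀ (by positivity)]
    linarith
  unfold bA
  rw [← hAdef]
  linarith

end Bilinear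

lemma isLinearMap_l2Inner_left (c : ℝ) (w : M.dgSpace) :
    IsLinearMap ℝ fun v : M.dgSpace => M.l2Inner (c • v.1) w := by
  unfold l2Inner
  exact isLinearMap_sum _ fun K => isLinearMap_integral
    (fun x => isLinearMap_mul_const _ (isLinearMap_const_mul c (isLinearMap_value K x)))
    fun v => M.integrable_cell_of_continuous
      (((continuous_dg v K).const_smul c).mul (continuous_dg w K))

lemma isLinearMap_l2Inner_right {f : M.Broken ℝ} (hf : ∀ K, Integrable (f K) (M.cellMeasure K)) :
    IsLinearMap ℝ fun w : M.dgSpace => M.l2Inner f w := by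
  unfold l2Inner
  exact isLinearMap_sum _ fun K => isLinearMap_integral
    (fun x => isLinearMap_const_mul _ (isLinearMap_value K x))
    fun w => BoundedMeasurableOn.integrable_mul
      (.of_continuous (M.cell K).isCompact_carrier (continuous_dg w K))
      (M.cell K).isCompact_carrier.measurableSet (hf K)

section RightHandSide

variable {Sa Sv : M.Broken ℝ} {lo hi lo' hi' : ℝ} (hmob : IsPositiveCoeff (D.mobA Sa Sv) lo hi)
  (hcoeff : IsPositiveCoeff (fun K x => D.kappa K * D.mobA Sa Sv K x) lo' hi')
  {u : M.Broken (Space d)} (hu : ∀ K, Continuous (u K))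

include hmob hu in
lemma boundedMeasurableOn_upwind (e : M.InteriorFacet) (Q : Set (Space d)) :
    BoundedMeasurableOn Q (D.upwind Sa Sv u e) := by
  classical
  have h1 := hmob.measurable e.left
  have h2 := hmob.measurable e.right
  have hu1 := (hu e.left).measurable
  have hu2 := (hu e.right).measurable
  refine ⟨?_, hi, fun x _ => ?_⟩
  · unfold upwind coeffG
    refine Measurable.ite (measurableSet_le measurable_const ?_) h1 h2
    fun_prop
  · unfold upwind
    split_ifs
    · rw [abs_of_pos (hmob.value_pos _ x)]; exact hmob.upper _ x
    · rw [abs_of_pos (hmob.value_pos _ x)]; exact hmob.upper _ x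

include hmob hcoeff hu in
lemma isLinearMap_fA (hd : 0 < d) (n : ℕ)
    (hq : ∀ K, Integrable (D.qA ((n + 1) * D.tau)) (M.cellMeasure K))
    (hjN : ∀ f : M.BoundaryFacet, f ∉ D.dirichlet →
      Integrable D.jN (M.facetMeasure f.1.1 f.1.2)) :
    IsLinearMap ℝ fun w : M.dgSpace => D.fA n Sa Sv u w := by
  classical
  unfold fA
  refine isLinearMap_sub (isLinearMap_sub (isLinearMap_add (isLinearMap_add
    (isLinearMap_l2Inner_right hq) ?_) ?_) ?_) ?_
  · refine isLinearMap_sum _ fun K => isLinearMap_integral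
      (fun x => isLinearMap_inner_brokenGrad _ _ _) fun w => ?_
    simp only [inner_add_left, inner_smul_left, conj_trivial]
    have h1 := hu K
    have h2 := continuous_brokenGrad w K
    have hK := (M.cell K).isCompact_carrier
    have hm := hmob.boundedMeasurableOn K (M.cell K).carrier
    exact M.integrable_cell ((hm.mul (.of_continuous hK (by fun_prop))).add
      ((hm.const_mul _).mul (.of_continuous hK (by fun_prop))))
  · have : ∀ w : M.dgSpace, ∑ f : M.BoundaryFacet with f ∉ D.dirichlet,
        ∫ x, D.jN x * w.1 f.1.1 x ∂M.facetMeasure f.1.1 f.1.2 = ∑ f : M.BoundaryFacet,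
        if f ∉ D.dirichlet then ∫ x, D.jN x * w.1 f.1.1 x ∂M.facetMeasure f.1.1 f.1.2 else 0 :=
      fun w => Finset.sum_filter _ _
    simp only [this]
    refine isLinearMap_sum _ fun f => ?_
    split_ifs with hf
    · exact ⟨fun _ _ => (add_zero 0).symm, fun _ _ => (smul_zero _).symm⟩
    · exact isLinearMap_integral (fun x => isLinearMap_const_mul _ (isLinearMap_value _ x))
        fun w => BoundedMeasurableOn.integrable_mul
          (.of_continuous ((M.cell f.1.1).isCompact_facet _) (continuous_dg w _))
          ((M.cell f.1.1).isCompact_facet _).measurableSet (hjN f hf)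
  · refine isLinearMap_sum _ fun e => isLinearMap_integral
      (fun x => isLinearMap_const_mul _ (isLinearMap_jump _ _)) fun w => ?_
    have h1 := hu e.left
    have hQ := (M.cell e.left).isCompact_facet e.leftLabel
    exact integrable_interiorFacet hd (((D.boundedMeasurableOn_upwind hmob hu e _).mul
      (.of_continuous hQ (by fun_prop))).mul (.of_continuous hQ (continuous_jump w e)))
  · refine isLinearMap_sum _ fun e => isLinearMap_integral
      (fun x => isLinearMap_const_mul _ (isLinearMap_jump _ _)) fun w => ?_
    have hQ := (M.cell e.left).isCompact_facet e.leftLabel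
    have hG : weightedAvg (D.coeffG Sa Sv) (fun _ _ => D.grav) e = fun x => D.rhoA *
        weightedAvg (fun K x => D.kappa K * D.mobA Sa Sv K x) (fun _ _ => D.grav) e x := by
      funext x
      rw [← weightedAvg_const_mul]
      simp only [coeffG, mul_assoc, weightedAvg]
    rw [hG]
    exact integrable_interiorFacet hd (((hcoeff.boundedMeasurableOn_weightedAvg
      (fun _ => continuous_const) e hQ).const_mul _).mul (.of_continuous hQ (continuous_jump w e)))

end RightHandSide

/-! ### Unique solvability -/

/-- The test space: discrete functions that vanish on the Dirichlet part of the boundary. -/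
def testSpace : Submodule ℝ (M.Broken ℝ) where
  carrier := {w | w ∈ M.dgSpace ∧ D.EqOnDirichlet w 0}
  zero_mem' := ⟨M.dgSpace.zero_mem, fun _ _ => ae_of_all _ fun _ => rfl⟩
  add_mem' {v w} hv hw := ⟨M.dgSpace.add_mem hv.1 hw.1, fun f hf => by
    filter_upwards [hv.2 f hf, hw.2 f hf] with x h1 h2
    simp only [Pi.add_apply, h1, h2, Pi.zero_apply, add_zero]⟩
  smul_mem' c v hv := ⟨M.dgSpace.smul_mem c hv.1, fun f hf => by
    filter_upwards [hv.2 f hf] with x h1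
    simp only [Pi.smul_apply, h1, Pi.zero_apply, smul_zero]⟩

lemma sub_mem_testSpace_iff {S g : M.Broken ℝ} (hS : S ∈ M.dgSpace) (hg : g ∈ M.dgSpace)
    (hgD : D.EqOnDirichlet g D.sBdy) :
    S - g ∈ D.testSpace ↔ D.EqOnDirichlet S D.sBdy := by
  constructor
  · rintro ⟨-, h⟩ f hf
    filter_upwards [h f hf, hgD f hf] with x h1 h2
    rw [← h2]
    exact sub_eq_zero.1 h1
  · intro h
    refine ⟨M.dgSpace.sub_mem hS hg, fun f hf => ?_⟩
    filter_upwards [h f hf, hgD f hf] with x h1 h2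
    change S f.1.1 x - g f.1.1 x = 0
    rw [h1, h2, sub_self]

/-- The penalty condition in the form in which the coercivity estimate uses it; the cubes only make
it stronger, since `lo ≤ hi`. -/
lemma penalty_bound {θ lo hi α C : ℝ} (hlo : 0 < lo) (hle : lo ≤ hi)
    (h : α > 1 / 4 * (1 - θ) ^ 2 * hi ^ 3 * (lo ^ 3)⁻¹ * C ^ 2) :
    (1 - θ) ^ 2 * hi * C ^ 2 ≤ 4 * α * lo := by
  have hratio : hi ≤ hi ^ 3 * (lo ^ 3)⁻¹ * lo := by
    have h1 : lo ^ 2 ≤ hi ^ 2 := pow_le_pow_left₀ hlo.le hle 2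
    have h2 : hi ^ 3 * (lo ^ 3)⁻¹ * lo = hi * hi ^ 2 / lo ^ 2 := by field_simp
    rw [h2, le_div_iff₀ (by positivity)]
    exact mul_le_mul_of_nonneg_left h1 (hlo.le.trans hle)
  have h3 := mul_le_mul_of_nonneg_left hratio
    (by positivity : 0 ≤ (1 - θ) ^ 2 * C ^ 2)
  have h4 := mul_le_mul_of_nonneg_right h.le hlo.le
  linarith

end FlowData

end ThreePhaseDG

end

open ThreePhaseDG ThreePhaseDG.Mesh ThreePhaseDG.FlowData in
theorem mainTheorem4 {s : ThreePhaseDG.Shape} {d : ℕ} (hd : d = 2 ∨ d = 3)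
    (M : ThreePhaseDG.Mesh s d) (D : ThreePhaseDG.FlowData M)
    (hphi : 0 < D.phi) (htau : 0 < D.tau)
    (htheta : D.theta = -1 ∨ D.theta = 0 ∨ D.theta = 1)
    -- bounds on the permeability, the aqueous mobility and the capillary pressure derivative
    (kLo kHi lLo lHi pLo pHi : ℝ)
    (hkLo : 0 < kLo) (hkappa : ∀ K, kLo ≤ D.kappa K ∧ D.kappa K ≤ kHi)
    (hlLo : 0 < lLo) (hlam : ∀ sa sv, lLo ≤ D.lamA sa sv ∧ D.lamA sa sv ≤ lHi)
    (hlamMeas : Measurable (Function.uncurry D.lamA))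
    (hpLo : 0 < pLo) (hpca : Differentiable ℝ D.pca)
    (hdpca : ∀ sa, pLo ≤ -deriv D.pca sa ∧ -deriv D.pca sa ≤ pHi)
    -- the penalty parameters
    (aLo aHi : ℝ) (haLo : 0 < aLo)
    (halpha : ∀ e ∈ D.skeleton.facets, aLo ≤ D.alphaA e ∧ D.alphaA e ≤ aHi)
    (Ctr : ℝ) (hCtr : M.IsTraceConstant Ctr)
    (hpenalty : aLo > 1 / 4 * (1 - D.theta) ^ 2 * (lHi * pHi * kHi) ^ 3 *
      ((lLo * pLo * kLo) ^ 3)⁻¹ * Ctr ^ 2)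
    -- the time step, the known discrete functions, and the source and boundary data
    (n : ℕ)
    (hq : MeasureTheory.MemLp (D.qA ((n + 1) * D.tau)) ⊤
      (MeasureTheory.volume.restrict M.domain))
    (hjN : ∀ f : M.BoundaryFacet, f ∉ D.dirichlet →
      MeasureTheory.Integrable D.jN (M.facetMeasure f.1.1 f.1.2))
    (hbdy : ∃ g ∈ M.dgSpace, D.EqOnDirichlet g D.sBdy)
    (Sa Sv P : M.Broken ℝ) (hSa : Sa ∈ M.dgSpace) (hSv : Sv ∈ M.dgSpace) (hP : P ∈ M.dgSpace)
    (u : M.Broken (ThreePhaseDG.Space d)) (hu : D.IsRTProjection Sa Sv P u) :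
    ∃! S, D.IsAqueousSolution n Sa Sv u S := by
  have hd0 : 0 < d := by omega
  obtain ⟨g, hg, hgD⟩ := hbdy
  have hSa' : ∀ K, Measurable (Sa K) := fun K => (continuous_dg ⟨Sa, hSa⟩ K).measurable
  have hSv' : ∀ K, Measurable (Sv K) := fun K => (continuous_dg ⟨Sv, hSv⟩ K).measurable
  have hmob : IsPositiveCoeff (D.mobA Sa Sv) lLo lHi :=
    ⟨fun K => hlamMeas.comp ((hSa' K).prodMk (hSv' K)), hlLo, fun K x => (hlam _ _).1,
      fun K x => (hlam _ _).2⟩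
  have hcoeff : IsPositiveCoeff (fun K x => D.kappa K * D.mobA Sa Sv K x) (kLo * lLo)
      (kHi * lHi) := by
    refine ⟨fun K => (hmob.measurable K).const_mul _, by positivity, fun K x => ?_, fun K x => ?_⟩
    · exact mul_le_mul (hkappa K).1 (hmob.lower K x) hlLo.le (hkLo.le.trans (hkappa K).1)
    · exact mul_le_mul (hkappa K).2 (hmob.upper K x) (hmob.value_pos K x).le
        (hkLo.le.trans ((hkappa K).1.trans (hkappa K).2))
  have hA : IsPositiveCoeff (D.coeffA Sa Sv) (lLo * pLo * kLo) (lHi * pHi * kHi) := by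
    refine ⟨fun K => (hcoeff.measurable K).mul ((measurable_deriv _).comp (hSa' K)).neg,
      by positivity, fun K x => ?_, fun K x => ?_⟩
    · calc lLo * pLo * kLo = kLo * lLo * pLo := by ring
        _ ≤ _ := mul_le_mul (hcoeff.lower K x) (hdpca _).1 hpLo.le (hcoeff.value_pos K x).le
    · calc _ ≤ kHi * lHi * pHi := mul_le_mul (hcoeff.upper K x) (hdpca _).2
            (hpLo.le.trans (hdpca _).1) ((hcoeff.value_pos K x).le.trans (hcoeff.upper K x))
        _ = _ := by ring
  have hpen := penalty_bound hA.pos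
    ((hA.lower ⟨0, M.numCells_pos⟩ 0).trans (hA.upper ⟨0, M.numCells_pos⟩ 0)) hpenalty
  have hq' : ∀ K, Integrable (D.qA ((n + 1) * D.tau)) (M.cellMeasure K) := by
    intro K
    have : IsFiniteMeasure (M.cellMeasure K) :=
      ⟨by simpa [cellMeasure] using (M.cell K).isCompact_carrier.measure_lt_top⟩
    exact (hq.mono_measure (restrict_carrier_le_restrict_domain K)).integrable le_top
  have hSaInt : ∀ K, Integrable ((D.phi • Sa) K) (M.cellMeasure K) := fun K =>
    M.integrable_cell_of_continuous ((continuous_dg ⟨Sa, hSa⟩ K).const_smul D.phi)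
  have hle : D.testSpace ≤ M.dgSpace := fun _ h => h.1
  have : FiniteDimensional ℝ D.testSpace := Submodule.finiteDimensional_of_le hle
  have main := existsUnique_of_definite hle
    (a := fun v w => 1 / D.tau * M.l2Inner (D.phi • v) w + D.bA Sa Sv v w)
    (l := fun w => 1 / D.tau * M.l2Inner (D.phi • Sa) w + D.fA n Sa Sv u w)
    (fun w hw => isLinearMap_add
      (isLinearMap_const_mul _ (isLinearMap_l2Inner_left _ ⟨w, hle hw⟩))
      (D.isLinearMap_bA_left hA hd0 ⟨w, hle hw⟩))
    (fun v hv => isLinearMap_add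
      (isLinearMap_const_mul _ (isLinearMap_l2Inner_right fun K =>
        M.integrable_cell_of_continuous ((continuous_dg ⟨v, hv⟩ K).const_smul D.phi)))
      (D.isLinearMap_bA_right hA hd0 ⟨v, hv⟩))
    (isLinearMap_add (isLinearMap_const_mul _ (isLinearMap_l2Inner_right hSaInt))
      (D.isLinearMap_fA hmob hcoeff (fun K => (hu.1 K).continuous) hd0 n hq' hjN))
    (fun z hz h => by
      have hb := D.bA_self_nonneg hA hd haLo (fun e he => (halpha e he).1) hCtr hpen hz.1
      have hl2 : M.l2Inner (D.phi • z) z =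
          D.phi * ∑ K, ∫ x, z K x ^ 2 ∂M.cellMeasure K := by
        rw [l2Inner, Finset.mul_sum]
        refine Finset.sum_congr rfl fun K _ => ?_
        rw [← integral_const_mul]
        refine integral_congr_ae (ae_of_all _ fun x => ?_)
        simp only [Pi.smul_apply, smul_eq_mul]
        ring
      have hnn : ∀ K ∈ Finset.univ, 0 ≤ ∫ x, z K x ^ 2 ∂M.cellMeasure K := fun K _ =>
        integral_nonneg fun _ => sq_nonneg _
      have hsum : ∑ K, ∫ x, z K x ^ 2 ∂M.cellMeasure K = 0 := by
        refine le_antisymm ?_ (Finset.sum_nonneg hnn)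
        by_contra! hpos
        have h' : 1 / D.tau * M.l2Inner (D.phi • z) z + D.bA Sa Sv z z = 0 := h
        rw [hl2] at h'
        have : 0 < 1 / D.tau * (D.phi * ∑ K, ∫ x, z K x ^ 2 ∂M.cellMeasure K) := by positivity
        linarith
      exact eq_zero_of_integral_sq_eq_zero hd0 hz.1 fun K =>
        (Finset.sum_eq_zero_iff_of_nonneg hnn).1 hsum K (Finset.mem_univ K))
    hg
  have hiff : ∀ S, D.IsAqueousSolution n Sa Sv u S ↔ S ∈ M.dgSpace ∧ S - g ∈ D.testSpace ∧
      ∀ w ∈ D.testSpace, 1 / D.tau * M.l2Inner (D.phi • S) w + D.bA Sa Sv S w =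
        1 / D.tau * M.l2Inner (D.phi • Sa) w + D.fA n Sa Sv u w := by
    intro S
    refine and_congr_right fun hS => and_congr (D.sub_mem_testSpace_iff hS hg hgD).symm ?_
    exact ⟨fun h w hw => h w hw.1 hw.2, fun h w hw hwD => h w ⟨hw, hwD⟩⟩
  exact (existsUnique_congr hiff).2 main
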